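/- Let $L:\mathbb R^2\to\mathbb R$ be continuous with $\Omega=\{q: L(q)\le 0\}$ bounded, and let $\rho$ be a measurable density on $\Omega$ with $0<\underline\rho\le\rho\le\bar\rho$. For $\mathbf r\in\mathbb R^2$ and phase angles $\varphi,\psi$ (taken modulo $2\pi$) let $\Omega(\varphi,\psi,\mathbf r)$ be the set of points of $\Omega$ lying in the closed sector with apex $\mathbf r$ swept counterclockwise from direction $\varphi$ to direction $\psi$ (opening angle in $[0,2\pi)$), and let $m(\varphi,\psi,\mathbf r)=\int_{\Omega(\varphi,\psi,\mathbf r)}\rho(\mathbf q)\,d\mathbf q$. For agents $i=1,\dots,N$, with indices modulo $N$, put $\Omega_i=\Omega(\varphi_i,\varphi_{i+1},\mathbf r_i)$ and $m_i=m(\varphi_i,\varphi_{i+1},\mathbf r_i)$. Let $\varphi_i(t),\mathbf r_i(t)$, $t\ge 0$, solve, with $\kappa_\varphi,\kappa_r>0$, $$\dot\varphi_i=-\kappa_\varphi\Big[(2m_i-m_{i-1}-m_{i+1})\tfrac{\partial m_i}{\partial\varphi_i}+(2m_{i-1}-m_{i-2}-m_i)\tfrac{\partial m_{i-1}}{\partial\varphi_i}\Big],$$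 $$\dot{\mathbf r}_i=-\kappa_r\Big[(2m_i-m_{i-1}-m_{i+1})\nabla_{\mathbf r_i}m_i+2\mathbf r_i-\mathbf r_{i-1}-\mathbf r_{i+1}\Big],$$ and suppose that the configurations $(\varphi_i,\varphi_{i+1},\mathbf r_i)(t)$ (angles modulo $2\pi$) stay in a compact set near every point of which the function $m$ is continuously differentiable. Let the service cost $f(\mathbf p,\mathbf q)$ be twice continuously differentiable in $\mathbf p\in\mathbb R^2$ for each $\mathbf q\in\Omega$, with $f$ and its first two $\mathbf p$-derivatives jointly continuous on $\mathbb R^2\times\Omega$; let $J_{\Omega_i}(\mathbf p)=\int_{\Omega_i}f(\mathbf p,\mathbf q)\rho(\mathbf q)\,d\mathbf q$ and $\Pi_i=\{\mathbf p\in\Omega_i:\nabla J_{\Omega_i}(\mathbf p)=0\}$. For an agent $i$, let $\mathbf p_i^*(t)$, $t\ge 0$, be differentiable in $t$ and, for each $t$, a minimizer of $J_{\Omega_i(t)}$ over $\Pi_i(t)$. If the Hessian matrix of $J_{\Omega_i(t)}$ at $\mathbf p_i^*(t)$ has rank $2$ for all $t\ge 0$, and every accumulation point of these matrices as $t\to\infty$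 also has rank $2$, then $$\lim_{t\to\infty}\dot{\mathbf p}_i^*(t)=\mathbf 0 .$$ -/

import Mathlib

open Filter Topology MeasureTheory

noncomputable section

/-- The Euclidean plane. -/
abbrev Plane : Type := EuclideanSpace ℝ (Fin 2)

/-- The unit vector with phase angle `α`. -/
def pointerDir (α : ℝ) : Plane := !₂[Real.cos α, Real.sin α]

/-- The coverage region `{q | L q ≤ 0}`. -/
def coverageRegion (L : Plane → ℝ) : Set Plane := {q | L q ≤ 0}

/-- The closed sector with apex `r` swept counterclockwise from the pointer with phase angle `φ`
to the pointer with phase angle `ψ`. Phase angles count modulo `2π`; the opening angle is the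
representative of `ψ - φ` in `[0, 2π)`. -/
def sector (φ ψ : ℝ) (r : Plane) : Set Plane :=
  {q | ∃ κ α : ℝ, 0 ≤ κ ∧ φ ≤ α ∧ α ≤ φ + toIcoMod Real.two_pi_pos 0 (ψ - φ) ∧
    q = r + κ • pointerDir α}

/-- The part of the coverage region between the two pointers issuing from `r`. -/
def subregion (L : Plane → ℝ) (φ ψ : ℝ) (r : Plane) : Set Plane :=
  coverageRegion L ∩ sector φ ψ r

/-- The workload `∫ ρ` of a subregion. -/
def workload (L ρ : Plane → ℝ) (φ ψ : ℝ) (r : Plane) : ℝ :=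
  ∫ q in subregion L φ ψ r, ρ q

/-- The local cost `p ↦ ∫ f(p, q) ρ(q) dq` of a subregion. -/
def localCost (L ρ : Plane → ℝ) (f : Plane → Plane → ℝ) (φ ψ : ℝ) (r p : Plane) : ℝ :=
  ∫ q in subregion L φ ψ r, f p q * ρ q

/-- The points of the subregion at which the gradient of the local cost vanishes. -/
def admissibleSet (L ρ : Plane → ℝ) (f : Plane → Plane → ℝ) (φ ψ : ℝ) (r : Plane) :
    Set Plane :=
  {p | p ∈ subregion L φ ψ r ∧ gradient (localCost L ρ f φ ψ r) p = 0}

/-- `p` minimizes the local cost over the admissible set. -/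
def IsOptimalPosition (L ρ : Plane → ℝ) (f : Plane → Plane → ℝ) (φ ψ : ℝ) (r p : Plane) :
    Prop :=
  p ∈ admissibleSet L ρ f φ ψ r ∧
    ∀ p' ∈ admissibleSet L ρ f φ ψ r, localCost L ρ f φ ψ r p ≤ localCost L ρ f φ ψ r p'

/-- The Hessian matrix of `J` at `p`. -/
def hessianMatrix (J : Plane → ℝ) (p : Plane) : Matrix (Fin 2) (Fin 2) ℝ :=
  Matrix.of fun a b =>
    fderiv ℝ (fderiv ℝ J) p (EuclideanSpace.single a 1) (EuclideanSpace.single b 1)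

section Agents

variable {N : ℕ} [NeZero N]

/-- The workload of agent `i`; indices are cyclic. -/
def agentWorkload (L ρ : Plane → ℝ) (φ : Fin N → ℝ) (r : Fin N → Plane) (i : Fin N) : ℝ :=
  workload L ρ (φ i) (φ (i + 1)) (r i)

/-- The partial derivative of the workload of agent `i` in its own phase angle. -/
def workloadDerivOwn (L ρ : Plane → ℝ) (φ : Fin N → ℝ) (r : Fin N → Plane) (i : Fin N) : ℝ :=
  deriv (fun a => workload L ρ a (φ (i + 1)) (r i)) (φ i)

/-- The partial derivative of the workload of agent `i` in the phase angle of agent `i + 1`. -/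
def workloadDerivNext (L ρ : Plane → ℝ) (φ : Fin N → ℝ) (r : Fin N → Plane) (i : Fin N) : ℝ :=
  deriv (fun b => workload L ρ (φ i) b (r i)) (φ (i + 1))

/-- The gradient of the workload of agent `i` in its reference point. -/
def workloadGradRef (L ρ : Plane → ℝ) (φ : Fin N → ℝ) (r : Fin N → Plane) (i : Fin N) : Plane :=
  gradient (fun x => workload L ρ (φ i) (φ (i + 1)) x) (r i)

/-- The right-hand side of the dynamics of the phase angle of agent `i`. -/
def phaseField (L ρ : Plane → ℝ) (kφ : ℝ) (φ : Fin N → ℝ) (r : Fin N → Plane) (i : Fin N) : ℝ :=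
  -kφ * ((2 * agentWorkload L ρ φ r i - agentWorkload L ρ φ r (i - 1)
            - agentWorkload L ρ φ r (i + 1)) * workloadDerivOwn L ρ φ r i
        + (2 * agentWorkload L ρ φ r (i - 1) - agentWorkload L ρ φ r (i - 2)
            - agentWorkload L ρ φ r i) * workloadDerivNext L ρ φ r (i - 1))

/-- The right-hand side of the dynamics of the reference point of agent `i`. -/
def refField (L ρ : Plane → ℝ) (kr : ℝ) (φ : Fin N → ℝ) (r : Fin N → Plane) (i : Fin N) :
    Plane :=
  -kr • ((2 * agentWorkload L ρ φ r i - agentWorkload L ρ φ r (i - 1)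
            - agentWorkload L ρ φ r (i + 1)) • workloadGradRef L ρ φ r i
        + ((2 : ℝ) • r i - r (i - 1) - r (i + 1)))

/-- `(φ, r)` solves the partition dynamics on `[0, ∞)`. The phase angles are followed
continuously in `ℝ`; only their classes modulo `2π` matter. -/
def SolvesPartitionDynamics (L ρ : Plane → ℝ) (kφ kr : ℝ)
    (φ : Fin N → ℝ → ℝ) (r : Fin N → ℝ → Plane) : Prop :=
  ∀ t : ℝ, 0 ≤ t → ∀ i : Fin N,
    HasDerivWithinAt (φ i)
      (phaseField L ρ kφ (fun j => φ j t) (fun j => r j t) i) (Set.Ici 0) t ∧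
    HasDerivWithinAt (r i)
      (refField L ρ kr (fun j => φ j t) (fun j => r j t) i) (Set.Ici 0) t

/-- The configurations `(φ_i, φ_{i+1}, r_i)` (phase angles modulo `2π`) stay in a compact set,
near every point of which the workload is a continuously differentiable function: the setting in
which the right-hand side of the partition dynamics is defined and continuous. -/
def StaysInRegularCompact (L ρ : Plane → ℝ) (φ : Fin N → ℝ → ℝ) (r : Fin N → ℝ → Plane) :
    Prop :=
  ∃ K : Set (ℝ × ℝ × Plane), IsCompact K ∧
    (∀ c ∈ K, ContDiffAt ℝ 1 (fun x : ℝ × ℝ × Plane => workload L ρ x.1 x.2.1 x.2.2) c) ∧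
    ∀ t : ℝ, 0 ≤ t → ∀ i : Fin N, ∃ k l : ℤ,
      (φ i t + k * (2 * Real.pi), φ (i + 1) t + l * (2 * Real.pi), r i t) ∈ K

/-- The Hessian matrix, at the point `p`, of the local cost of agent `i` at time `t`. -/
def agentHessian (L ρ : Plane → ℝ) (f : Plane → Plane → ℝ) (φ : Fin N → ℝ → ℝ)
    (r : Fin N → ℝ → Plane) (i : Fin N) (t : ℝ) (p : Plane) : Matrix (Fin 2) (Fin 2) ℝ :=
  hessianMatrix (localCost L ρ f (φ i t) (φ (i + 1) t) (r i t)) p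

end Agents

end

/-! Why the theorem holds. Put V = ½ ∑ (m_i - m_{i-1})² + ½ ∑ |r_i - r_{i-1}|². By cyclic summation
by parts, the partition dynamics are the gradient flow of V with gains kφ and kr, so V' = -W, where
W is the weighted sum of the squared gradient components (`hasDerivWithinAt_balanceEnergy`). Modulo
periods the configurations stay in a compact set on which m is C¹. Hence W is bounded, the
velocities are bounded, and W is uniformly continuous in time. As V ≥ 0 is decreasing, Barbalat's
argument gives W → 0, and with it every configuration velocity tends to zero
(`tendsto_configVelocity`).

The optimal position satisfies ∇J_t(p*(t)) = 0. An implicit-function estimate replaces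
differentiation of J in the shape of the subregion: with the region frozen at time t, ∇J_t(p*(s)) =
∇J_t(p*(s)) - ∇J_s(p*(s)) is a difference of integrals of one integrand over two subregions. It is
Lipschitz in the configuration, since the symmetric difference of nearby sectors lies in thin strips
along their boundary lines (`norm_integral_subregion_sub_le`). Letting s → t gives ‖Hess J_t(p*) ·
p*'‖ ≤ C ‖configuration velocity‖ → 0.

The Hessians are bounded and their accumulation points invertible, so p*' → 0
(`tendsto_zero_of_tendsto_vecMul`). Sectors do jump when the two pointers coincide. There m would be
discontinuous unless Ω is a null set, and a null Ω makes the Hessian zero, against the rank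
hypothesis. -/

noncomputable section

/-! ### Sectors described by half-planes -/

/-- The signed distance of `x` from the line through the origin with phase angle `a`. -/
def lineDist (a : ℝ) (x : Plane) : ℝ := Real.cos a * x 1 - Real.sin a * x 0

theorem Plane.abs_coord_le (x : Plane) (j : Fin 2) : |x j| ≤ ‖x‖ := by
  simpa using PiLp.norm_apply_le x j

theorem lineDist_sub (a : ℝ) (x y : Plane) :
    lineDist a (x - y) = lineDist a x - lineDist a y := by
  simp [lineDist]; ring

theorem lineDist_smul_pointerDir (a b κ : ℝ) :
    lineDist a (κ • pointerDir b) = κ * Real.sin (b - a) := by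
  simp [lineDist, pointerDir, Real.sin_sub]; ring

theorem abs_lineDist_le (a : ℝ) (x : Plane) : |lineDist a x| ≤ 2 * ‖x‖ := by
  have h0 := Plane.abs_coord_le x 0
  have h1 := Plane.abs_coord_le x 1
  have e1 : |Real.cos a * x 1| ≤ 1 * ‖x‖ := by
    rw [abs_mul]; exact mul_le_mul (Real.abs_cos_le_one a) h1 (abs_nonneg _) zero_le_one
  have e0 : |Real.sin a * x 0| ≤ 1 * ‖x‖ := by
    rw [abs_mul]; exact mul_le_mul (Real.abs_sin_le_one a) h0 (abs_nonneg _) zero_le_one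
  unfold lineDist
  linarith [abs_sub (Real.cos a * x 1) (Real.sin a * x 0)]

theorem abs_lineDist_sub_angle_le (a b : ℝ) (x : Plane) :
    |lineDist a x - lineDist b x| ≤ 2 * |a - b| * ‖x‖ := by
  have h0 := Plane.abs_coord_le x 0
  have h1 := Plane.abs_coord_le x 1
  have e1 : |(Real.cos a - Real.cos b) * x 1| ≤ |a - b| * ‖x‖ := by
    rw [abs_mul]
    exact mul_le_mul (Real.abs_cos_sub_cos_le a b) h1 (abs_nonneg _) (abs_nonneg _)
  have e0 : |(Real.sin a - Real.sin b) * x 0| ≤ |a - b| * ‖x‖ := by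
    rw [abs_mul]
    exact mul_le_mul (Real.abs_sin_sub_sin_le a b) h0 (abs_nonneg _) (abs_nonneg _)
  have : lineDist a x - lineDist b x
      = (Real.cos a - Real.cos b) * x 1 - (Real.sin a - Real.sin b) * x 0 := by
    unfold lineDist; ring
  rw [this]
  linarith [abs_sub ((Real.cos a - Real.cos b) * x 1) ((Real.sin a - Real.sin b) * x 0)]

theorem abs_lineDist_sub_le (a b : ℝ) (x y : Plane) :
    |lineDist a x - lineDist b y| ≤ 2 * |a - b| * ‖x‖ + 2 * ‖x - y‖ := by
  have h1 := abs_lineDist_sub_angle_le a b x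
  have h2 := abs_lineDist_le b (x - y)
  rw [lineDist_sub] at h2
  linarith [abs_sub_le (lineDist a x) (lineDist b x) (lineDist b y)]

/-- Polar coordinates with phase angle counted from `φ`. -/
theorem exists_polar (φ : ℝ) (x : Plane) :
    ∃ τ : ℝ, 0 ≤ τ ∧ τ < 2 * Real.pi ∧ x = ‖x‖ • pointerDir (φ + τ) := by
  set z : ℂ := ⟨x 0, x 1⟩ with hz
  have hn : ‖z‖ = ‖x‖ := by
    rw [EuclideanSpace.norm_eq, Complex.norm_def, Complex.normSq_apply]
    simp [hz, Fin.sum_univ_two, sq]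
  refine ⟨toIcoMod Real.two_pi_pos 0 (z.arg - φ), left_le_toIcoMod _ _ _, ?_, ?_⟩
  · simpa using toIcoMod_lt_right Real.two_pi_pos 0 (z.arg - φ)
  · have e : φ + toIcoMod Real.two_pi_pos 0 (z.arg - φ)
        = z.arg - (toIcoDiv Real.two_pi_pos 0 (z.arg - φ) : ℤ) * (2 * Real.pi) := by
      rw [toIcoMod, zsmul_eq_mul]; ring
    rw [e]
    ext j
    fin_cases j <;> simp [pointerDir, ← hn, hz]

/-- Away from the apex the polar angle is unique within a window of length 2π starting at φ, and the
opening angle is less than 2π. -/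
theorem mem_sector_iff_of_polar {φ ψ : ℝ} {r q : Plane} (hq : q ≠ r) {τ : ℝ} (h0 : 0 ≤ τ)
    (h1 : τ < 2 * Real.pi) (h : q - r = ‖q - r‖ • pointerDir (φ + τ)) :
    q ∈ sector φ ψ r ↔ τ ≤ toIcoMod Real.two_pi_pos 0 (ψ - φ) := by
  set ω := toIcoMod Real.two_pi_pos 0 (ψ - φ) with hω
  have hω1 : ω < 2 * Real.pi := by
    simpa using toIcoMod_lt_right Real.two_pi_pos 0 (ψ - φ)
  have hpos : 0 < ‖q - r‖ := norm_pos_iff.2 (sub_ne_zero.2 hq)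
  constructor
  · rintro ⟨κ, α, hκ, hα0, hα1, hqα⟩
    have hqα' : q - r = κ • pointerDir α := by rw [hqα]; simp
    have key : ∀ β : ℝ, ‖pointerDir β‖ = 1 := fun β => by
      rw [EuclideanSpace.norm_eq]; simp [pointerDir, Fin.sum_univ_two]
    have hκn : ‖q - r‖ = κ := by
      rw [hqα', norm_smul, key, mul_one, Real.norm_of_nonneg hκ]
    rw [hκn, hqα'] at h
    rw [hκn] at hpos
    have h' : pointerDir α = pointerDir (φ + τ) := smul_right_injective _ hpos.ne' h
    have hc : Real.cos α = Real.cos (φ + τ) := by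
      simpa [pointerDir] using congrArg (fun v : Plane => v 0) h'
    have hs : Real.sin α = Real.sin (φ + τ) := by
      simpa [pointerDir] using congrArg (fun v : Plane => v 1) h'
    -- Both angles lie in [φ, φ + 2π), so their difference lies strictly between -2π and 2π, where
    -- the cosine equals 1 only at 0.
    have hone : Real.cos (α - (φ + τ)) = 1 := by
      rw [Real.cos_sub, hc, hs]; nlinarith [Real.sin_sq_add_cos_sq (φ + τ)]
    have := (Real.cos_eq_one_iff_of_lt_of_lt (by linarith) (by linarith)).1 hone
    linarith
  · intro hτ
    exact ⟨‖q - r‖, φ + τ, norm_nonneg _, by linarith, by linarith, by rw [← h]; simp⟩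

theorem apex_mem_sector (φ ψ : ℝ) (r : Plane) : r ∈ sector φ ψ r :=
  ⟨0, φ, le_rfl, le_rfl, by linarith [left_le_toIcoMod Real.two_pi_pos 0 (ψ - φ)], by simp⟩

/-- The opening angle differs from ψ - φ by a multiple of 2π, which the sine ignores. Both boundary
conditions can thus be read off from τ. -/
theorem lineDist_right_eq (φ ψ τ κ : ℝ) :
    lineDist ψ (κ • pointerDir (φ + τ))
      = -(κ * Real.sin (toIcoMod Real.two_pi_pos 0 (ψ - φ) - τ)) := by
  rw [lineDist_smul_pointerDir, toIcoMod, zsmul_eq_mul, ← mul_neg, ← Real.sin_neg]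
  congr 1
  rw [show -(ψ - φ - (toIcoDiv Real.two_pi_pos 0 (ψ - φ) : ℤ) * (2 * Real.pi) - τ)
    = (φ + τ - ψ) + (toIcoDiv Real.two_pi_pos 0 (ψ - φ) : ℤ) * (2 * Real.pi) by ring,
    Real.sin_add_int_mul_two_pi]

/-- A sector with opening angle at most `π` is an intersection of two half-planes. -/
theorem mem_sector_iff_and {φ ψ : ℝ} {r q : Plane}
    (h0 : 0 < toIcoMod Real.two_pi_pos 0 (ψ - φ))
    (h1 : toIcoMod Real.two_pi_pos 0 (ψ - φ) ≤ Real.pi) :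
    q ∈ sector φ ψ r ↔ 0 ≤ lineDist φ (q - r) ∧ lineDist ψ (q - r) ≤ 0 := by
  rcases eq_or_ne q r with rfl | hq
  · simp [apex_mem_sector, lineDist]
  obtain ⟨τ, hτ0, hτ1, h⟩ := exists_polar φ (q - r)
  have hpos : 0 < ‖q - r‖ := norm_pos_iff.2 (sub_ne_zero.2 hq)
  rw [mem_sector_iff_of_polar hq hτ0 hτ1 h, h,
    lineDist_right_eq φ ψ τ, lineDist_smul_pointerDir,
    add_sub_cancel_left, neg_nonpos, mul_nonneg_iff_of_pos_left hpos,
    mul_nonneg_iff_of_pos_left hpos]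
  set ω := toIcoMod Real.two_pi_pos 0 (ψ - φ)
  constructor
  · intro hτ
    exact ⟨Real.sin_nonneg_of_nonneg_of_le_pi hτ0 (by linarith),
      Real.sin_nonneg_of_nonneg_of_le_pi (by linarith) (by linarith)⟩
  · rintro ⟨hs1, hs2⟩
    by_contra! hlt
    -- The first half-plane excludes τ > π. Then τ - ω lies in (0, π), and the second half-plane
    -- excludes that.
    have hτπ : τ ≤ Real.pi := by
      by_contra! hgt
      have : 0 < Real.sin (τ - Real.pi) := Real.sin_pos_of_pos_of_lt_pi (by linarith) (by linarith)
      rw [Real.sin_sub_pi] at this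
      linarith
    have : 0 < Real.sin (τ - ω) := Real.sin_pos_of_pos_of_lt_pi (by linarith) (by linarith)
    rw [← neg_sub, Real.sin_neg] at this
    linarith

/-- A sector with opening angle at least `π` is a union of two half-planes. -/
theorem mem_sector_iff_or {φ ψ : ℝ} {r q : Plane}
    (h1 : Real.pi ≤ toIcoMod Real.two_pi_pos 0 (ψ - φ)) :
    q ∈ sector φ ψ r ↔ 0 ≤ lineDist φ (q - r) ∨ lineDist ψ (q - r) ≤ 0 := by
  rcases eq_or_ne q r with rfl | hq
  · simp [apex_mem_sector, lineDist]
  obtain ⟨τ, hτ0, hτ1, h⟩ := exists_polar φ (q - r)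
  have hpos : 0 < ‖q - r‖ := norm_pos_iff.2 (sub_ne_zero.2 hq)
  have hω1 : toIcoMod Real.two_pi_pos 0 (ψ - φ) < 2 * Real.pi := by
    simpa using toIcoMod_lt_right Real.two_pi_pos 0 (ψ - φ)
  rw [mem_sector_iff_of_polar hq hτ0 hτ1 h, h,
    lineDist_right_eq φ ψ τ, lineDist_smul_pointerDir,
    add_sub_cancel_left, neg_nonpos, mul_nonneg_iff_of_pos_left hpos,
    mul_nonneg_iff_of_pos_left hpos]
  set ω := toIcoMod Real.two_pi_pos 0 (ψ - φ)
  constructor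
  · intro hτ
    rcases le_total τ Real.pi with h | h
    · exact Or.inl (Real.sin_nonneg_of_nonneg_of_le_pi hτ0 h)
    · exact Or.inr (Real.sin_nonneg_of_nonneg_of_le_pi (by linarith) (by linarith))
  · intro hs
    by_contra! hlt
    rcases hs with hs | hs
    · have : 0 < Real.sin (τ - Real.pi) :=
        Real.sin_pos_of_pos_of_lt_pi (by linarith) (by linarith)
      rw [Real.sin_sub_pi] at this
      linarith
    · have : 0 < Real.sin (τ - ω) := Real.sin_pos_of_pos_of_lt_pi (by linarith) (by linarith)
      rw [← neg_sub, Real.sin_neg] at this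
      linarith

/-- A point that lies in one of two sectors with comparable opening angles but not in the other is
close to the boundary lines of the former. -/
theorem near_boundary_of_mem_sector_of_notMem {φ ψ φ' ψ' : ℝ} {r r' q : Plane}
    (h : (0 < toIcoMod Real.two_pi_pos 0 (ψ - φ) ∧ toIcoMod Real.two_pi_pos 0 (ψ - φ) ≤ Real.pi ∧
        0 < toIcoMod Real.two_pi_pos 0 (ψ' - φ') ∧
        toIcoMod Real.two_pi_pos 0 (ψ' - φ') ≤ Real.pi) ∨
      (Real.pi ≤ toIcoMod Real.two_pi_pos 0 (ψ - φ) ∧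
        Real.pi ≤ toIcoMod Real.two_pi_pos 0 (ψ' - φ')))
    (hq : q ∈ sector φ ψ r) (hq' : q ∉ sector φ' ψ' r') :
    |lineDist φ (q - r)| ≤ 2 * |φ - φ'| * ‖q - r‖ + 2 * ‖r - r'‖ ∨
      |lineDist ψ (q - r)| ≤ 2 * |ψ - ψ'| * ‖q - r‖ + 2 * ‖r - r'‖ := by
  have e1 := abs_lineDist_sub_le φ φ' (q - r) (q - r')
  have e2 := abs_lineDist_sub_le ψ ψ' (q - r) (q - r')
  rw [sub_sub_sub_cancel_left, norm_sub_rev r' r] at e1 e2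
  -- The signed distance changes sign between the two configurations, so its size is at most its
  -- variation.
  have fwd : 0 ≤ lineDist φ (q - r) → lineDist φ' (q - r') < 0 →
      |lineDist φ (q - r)| ≤ 2 * |φ - φ'| * ‖q - r‖ + 2 * ‖r - r'‖ := fun a b => by
    rw [abs_of_nonneg a]; linarith [le_abs_self (lineDist φ (q - r) - lineDist φ' (q - r'))]
  have bwd : lineDist ψ (q - r) ≤ 0 → 0 < lineDist ψ' (q - r') →
      |lineDist ψ (q - r)| ≤ 2 * |ψ - ψ'| * ‖q - r‖ + 2 * ‖r - r'‖ := fun a b => by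
    rw [abs_of_nonpos a]
    linarith [neg_le_abs (lineDist ψ (q - r) - lineDist ψ' (q - r'))]
  rcases h with ⟨a, b, c, d⟩ | ⟨b, d⟩
  · rw [mem_sector_iff_and a b] at hq
    rw [mem_sector_iff_and c d, not_and_or, not_le, not_le] at hq'
    exact hq'.imp (fwd hq.1) (bwd hq.2)
  · rw [mem_sector_iff_or b] at hq
    rw [mem_sector_iff_or d, not_or, not_le, not_le] at hq'
    exact hq.imp (fun x => fwd x hq'.1) (fun x => bwd x hq'.2)

theorem sector_add_int_mul_two_pi (φ ψ : ℝ) (k l : ℤ) (r : Plane) :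
    sector (φ + k * (2 * Real.pi)) (ψ + l * (2 * Real.pi)) r = sector φ ψ r := by
  have key : ∀ (φ ψ : ℝ) (k l : ℤ),
      sector φ ψ r ⊆ sector (φ + k * (2 * Real.pi)) (ψ + l * (2 * Real.pi)) r := by
    rintro φ ψ k l q ⟨κ, α, h0, h1, h2, rfl⟩
    have e : toIcoMod Real.two_pi_pos 0 (ψ + l * (2 * Real.pi) - (φ + k * (2 * Real.pi)))
        = toIcoMod Real.two_pi_pos 0 (ψ - φ) := by
      rw [← toIcoMod_add_zsmul Real.two_pi_pos 0 (ψ - φ) (l - k)]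
      congr 1
      rw [zsmul_eq_mul]; push_cast; ring
    refine ⟨κ, α + k * (2 * Real.pi), h0, by linarith, by rw [e]; linarith, ?_⟩
    simp [pointerDir]
  refine Set.Subset.antisymm ?_ (key φ ψ k l)
  refine (key _ _ (-k) (-l)).trans (Eq.subset ?_)
  congr 1 <;> push_cast <;> ring

/-! ### Measurability of sectors and area of strips -/

theorem measurableSet_sector (φ ψ : ℝ) (r : Plane) : MeasurableSet (sector φ ψ r) := by
  set ω := toIcoMod Real.two_pi_pos 0 (ψ - φ)
  have hcont : Continuous fun z : ℝ × ℝ => r + z.1 • pointerDir z.2 := by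
    unfold pointerDir; fun_prop
  have : sector φ ψ r = ⋃ n : ℕ, (fun z : ℝ × ℝ => r + z.1 • pointerDir z.2) ''
      (Set.Icc 0 (n : ℝ) ×ˢ Set.Icc φ (φ + ω)) := by
    ext q
    simp only [Set.mem_iUnion, Set.mem_image, Set.mem_prod, Set.mem_Icc, Prod.exists]
    constructor
    · rintro ⟨κ, α, h0, h1, h2, rfl⟩
      obtain ⟨n, hn⟩ := exists_nat_ge κ
      exact ⟨n, κ, α, ⟨⟨h0, hn⟩, h1, h2⟩, rfl⟩
    · rintro ⟨n, κ, α, ⟨⟨h0, hn⟩, h1, h2⟩, rfl⟩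
      exact ⟨κ, α, h0, h1, h2, rfl⟩
  rw [this]
  exact MeasurableSet.iUnion fun n =>
    ((isCompact_Icc.prod isCompact_Icc).image hcont).isClosed.measurableSet

/-- The rotation of the plane by the angle `-a`. -/
def rotationEquiv (a : ℝ) : Plane ≃ₗᵢ[ℝ] Plane :=
  LinearIsometry.toLinearIsometryEquiv
    { toFun := fun x => !₂[Real.cos a * x 0 + Real.sin a * x 1, lineDist a x]
      map_add' := fun x y => by
        ext j; fin_cases j <;> simp [lineDist] <;> ring
      map_smul' := fun c x => by
        ext j; fin_cases j <;> simp [lineDist] <;> ring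
      norm_map' := fun x => by
        simp only [LinearMap.coe_mk, AddHom.coe_mk]
        rw [EuclideanSpace.norm_eq, EuclideanSpace.norm_eq]
        congr 1
        simp only [Fin.sum_univ_two, Real.norm_eq_abs, sq_abs, lineDist]
        simp
        linear_combination (x 0 ^ 2 + x 1 ^ 2) * Real.sin_sq_add_cos_sq a } rfl

theorem rotationEquiv_apply_one (a : ℝ) (x : Plane) : rotationEquiv a x 1 = lineDist a x := by
  simp [rotationEquiv]

theorem volume_abs_coord_le (M δ : ℝ) (hM : 0 ≤ M) :
    volume {y : Plane | |y 0| ≤ M ∧ |y 1| ≤ δ} ≤ ENNReal.ofReal (4 * M * δ) := by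
  have hp := EuclideanSpace.volume_preserving_symm_measurableEquiv_toLp (Fin 2)
  have : {y : Plane | |y 0| ≤ M ∧ |y 1| ≤ δ} =
      (MeasurableEquiv.toLp 2 (Fin 2 → ℝ)).symm ⁻¹' Set.Icc ![-M, -δ] ![M, δ] := by
    ext y
    simp [Set.mem_Icc, Pi.le_def, Fin.forall_fin_two, abs_le]
    tauto
  rw [this, hp.measure_preimage measurableSet_Icc.nullMeasurableSet, Real.volume_Icc_pi,
    Fin.prod_univ_two]
  simp only [Matrix.cons_val_zero, Matrix.cons_val_one]
  rw [← ENNReal.ofReal_mul (by linarith)]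
  exact ENNReal.ofReal_le_ofReal (le_of_eq (by ring))

/-- The part within distance `M` of `r` of the strip of half-width `δ` around the line through `r`
with phase angle `a`. -/
def strip (a : ℝ) (r : Plane) (M δ : ℝ) : Set Plane :=
  {q | ‖q - r‖ ≤ M ∧ |lineDist a (q - r)| ≤ δ}

/-- Translating r to the origin and rotating by -a preserves area and carries the strip into a 2M ×
2δ box. -/
theorem volume_strip_le (a : ℝ) (r : Plane) (M δ : ℝ) (hM : 0 ≤ M) :
    volume (strip a r M δ) ≤ ENNReal.ofReal (4 * M * δ) := by
  have h1 : strip a r M δ ⊆ (fun q => q - r) ⁻¹'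
      (rotationEquiv a ⁻¹' {y : Plane | |y 0| ≤ M ∧ |y 1| ≤ δ}) := by
    rintro q ⟨h1, h2⟩
    refine ⟨?_, by rwa [rotationEquiv_apply_one]⟩
    refine (Plane.abs_coord_le _ 0).trans ?_
    rwa [LinearIsometryEquiv.norm_map]
  have hm : MeasurableSet {y : Plane | |y 0| ≤ M ∧ |y 1| ≤ δ} := by
    exact (measurableSet_le (f := fun y : Plane => |y 0|) (by fun_prop) measurable_const).inter
      (measurableSet_le (f := fun y : Plane => |y 1|) (by fun_prop) measurable_const)
  refine (measure_mono h1).trans ?_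
  rw [(measurePreserving_sub_right volume r).measure_preimage
    ((rotationEquiv a).continuous.measurable hm).nullMeasurableSet,
    (rotationEquiv a).measurePreserving.measure_preimage hm.nullMeasurableSet]
  exact volume_abs_coord_le M δ hM

theorem isCompact_coverageRegion {L : Plane → ℝ} (hL : Continuous L)
    (hΩ : Bornology.IsBounded (coverageRegion L)) : IsCompact (coverageRegion L) :=
  Metric.isCompact_of_isClosed_isBounded (isClosed_le hL continuous_const) hΩ

theorem measurableSet_subregion {L : Plane → ℝ} (hL : Continuous L) (φ ψ : ℝ) (r : Plane) :
    MeasurableSet (subregion L φ ψ r) :=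
  (isClosed_le hL continuous_const).measurableSet.inter (measurableSet_sector φ ψ r)

/-! ### Integrals over parts of a compact set -/

section Integrals

variable {E : Type*} [NormedAddCommGroup E] [NormedSpace ℝ E]

/-- A bounded weight times a continuous function is integrable on a compact set. -/
theorem integrableOn_smul_of_continuousOn {X : Type*} [TopologicalSpace X] [MeasurableSpace X]
    [OpensMeasurableSpace X] [T2Space X] [SecondCountableTopology X] {μ : Measure X}
    [IsFiniteMeasureOnCompacts μ] {Ω : Set X} (hΩ : IsCompact Ω) {ρ : X → ℝ} {R : ℝ}
    (hρ : ∀ q ∈ Ω, |ρ q| ≤ R) (hρm : AEStronglyMeasurable ρ (μ.restrict Ω))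
    {g : X → E} (hg : ContinuousOn g Ω) : IntegrableOn (fun q => ρ q • g q) Ω μ := by
  obtain ⟨B, hB⟩ := hΩ.exists_bound_of_continuousOn hg
  have : IsFiniteMeasure (μ.restrict Ω) := ⟨by simpa using hΩ.measure_lt_top⟩
  refine Integrable.of_bound (C := R * B)
    (hρm.smul (hg.aestronglyMeasurable_of_isCompact hΩ hΩ.measurableSet)) ?_
  filter_upwards [ae_restrict_mem hΩ.measurableSet] with q hq
  rw [norm_smul]
  exact mul_le_mul (hρ q hq) (hB q hq) (norm_nonneg _) ((abs_nonneg _).trans (hρ q hq))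

/-- Differentiation under the integral sign over a part of a compact set. -/
theorem hasFDerivAt_setIntegral_smul {P : Type*} [NormedAddCommGroup P] [NormedSpace ℝ P]
    [ProperSpace P] {X : Type*} [TopologicalSpace X] [MeasurableSpace X]
    [OpensMeasurableSpace X] [T2Space X] [SecondCountableTopology X] {μ : Measure X}
    [IsFiniteMeasureOnCompacts μ] {Ω S : Set X} (hΩ : IsCompact Ω) (hS : MeasurableSet S)
    (hSΩ : S ⊆ Ω) {ρ : X → ℝ} {R : ℝ}
    (hρ : ∀ q ∈ Ω, |ρ q| ≤ R) (hρm : AEStronglyMeasurable ρ (μ.restrict Ω))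
    {F : P → X → E} {D : P → X → P →L[ℝ] E}
    (hF : ContinuousOn (fun z : P × X => F z.1 z.2) (Set.univ ×ˢ Ω))
    (hD : ContinuousOn (fun z : P × X => D z.1 z.2) (Set.univ ×ˢ Ω))
    (hFD : ∀ q ∈ Ω, ∀ p, HasFDerivAt (fun p => F p q) (D p q) p) (p : P) :
    HasFDerivAt (fun p => ∫ q in S, ρ q • F p q ∂μ) (∫ q in S, ρ q • D p q ∂μ) p := by
  have hFs : ∀ p, ContinuousOn (F p) Ω := fun p =>
    hF.comp (f := fun q => (p, q)) (by fun_prop) fun q hq => ⟨trivial, hq⟩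
  have hDs : ∀ p, ContinuousOn (D p) Ω := fun p =>
    hD.comp (f := fun q => (p, q)) (by fun_prop) fun q hq => ⟨trivial, hq⟩
  obtain ⟨B, hB⟩ := ((isCompact_closedBall p 1).prod hΩ).exists_bound_of_continuousOn
    (hD.mono (Set.prod_mono (Set.subset_univ _) subset_rfl))
  have hfin : μ S < ⊤ := (measure_mono hSΩ).trans_lt hΩ.measure_lt_top
  have hmem : ∀ᵐ q ∂(μ.restrict S), q ∈ S := ae_restrict_mem hS
  refine hasFDerivAt_integral_of_dominated_of_fderiv_le (s := Metric.closedBall p 1)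
    (F := fun p q => ρ q • F p q) (F' := fun p q => ρ q • D p q)
    (bound := fun _ => R * B) (Metric.closedBall_mem_nhds p one_pos)
    (Eventually.of_forall fun x =>
      ((integrableOn_smul_of_continuousOn hΩ hρ hρm (hFs x)).mono_set hSΩ).1)
    ((integrableOn_smul_of_continuousOn hΩ hρ hρm (hFs p)).mono_set hSΩ)
    ((integrableOn_smul_of_continuousOn hΩ hρ hρm (hDs p)).mono_set hSΩ).1 ?_
    (integrableOn_const hfin.ne) ?_
  · filter_upwards [hmem] with q hq x hx
    rw [norm_smul]
    exact mul_le_mul (hρ q (hSΩ hq)) (hB (x, q) ⟨hx, hSΩ hq⟩) (norm_nonneg _)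
      ((abs_nonneg _).trans (hρ q (hSΩ hq)))
  · filter_upwards [hmem] with q hq x _
    exact (hFD q (hSΩ hq) x).const_smul (ρ q)

/-- The contributions of A ∩ B cancel. -/
theorem norm_setIntegral_sub_setIntegral_le {X : Type*} [MeasurableSpace X] {μ : Measure X}
    {A B : Set X} (hA : MeasurableSet A) (hB : MeasurableSet B) {g : X → E}
    (hgA : IntegrableOn g A μ) (hgB : IntegrableOn g B μ) {C : ℝ} (hCA : ∀ q ∈ A, ‖g q‖ ≤ C)
    (hCB : ∀ q ∈ B, ‖g q‖ ≤ C) (hA' : μ A < ⊤) (hB' : μ B < ⊤) :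
    ‖(∫ q in A, g q ∂μ) - ∫ q in B, g q ∂μ‖ ≤ C * μ.real (A \ B) + C * μ.real (B \ A) := by
  rw [← integral_inter_add_sdiff hB hgA, ← integral_inter_add_sdiff hA hgB, Set.inter_comm B A,
    add_sub_add_left_eq_sub]
  refine (norm_sub_le _ _).trans (add_le_add ?_ ?_)
  · exact norm_setIntegral_le_of_norm_le_const ((measure_mono Set.sdiff_subset).trans_lt hA')
      fun q hq => hCA q hq.1
  · exact norm_setIntegral_le_of_norm_le_const ((measure_mono Set.sdiff_subset).trans_lt hB')
      fun q hq => hCB q hq.1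

end Integrals

/-! ### Dependence of subregion integrals on the configuration -/

/-- Two pairs of pointers whose opening angles are positive and lie on the same side of `π`. -/
def ComparablePointers (φ ψ φ' ψ' : ℝ) : Prop :=
  (0 < toIcoMod Real.two_pi_pos 0 (ψ - φ) ∧ toIcoMod Real.two_pi_pos 0 (ψ - φ) ≤ Real.pi ∧
      0 < toIcoMod Real.two_pi_pos 0 (ψ' - φ') ∧
      toIcoMod Real.two_pi_pos 0 (ψ' - φ') ≤ Real.pi) ∨
    (Real.pi ≤ toIcoMod Real.two_pi_pos 0 (ψ - φ) ∧
      Real.pi ≤ toIcoMod Real.two_pi_pos 0 (ψ' - φ'))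

theorem ComparablePointers.symm {φ ψ φ' ψ' : ℝ} (h : ComparablePointers φ ψ φ' ψ') :
    ComparablePointers φ' ψ' φ ψ := by
  unfold ComparablePointers at *; tauto

/-- The opening angle is continuous away from 0. At exactly π both half-plane descriptions are
valid, so nearby sectors on either side of π remain comparable. -/
theorem eventually_comparablePointers {ι : Type*} {l : Filter ι} {φ ψ : ℝ} {a b : ι → ℝ}
    (ha : Tendsto a l (𝓝 φ)) (hb : Tendsto b l (𝓝 ψ))
    (h : toIcoMod Real.two_pi_pos 0 (ψ - φ) ≠ 0) :
    ∀ᶠ s in l, ComparablePointers φ ψ (a s) (b s) := by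
  have hpos : 0 < toIcoMod Real.two_pi_pos 0 (ψ - φ) :=
    lt_of_le_of_ne (left_le_toIcoMod _ _ _) h.symm
  have hc : ContinuousAt (toIcoMod Real.two_pi_pos 0) (ψ - φ) := by
    refine continuousAt_toIcoMod _ _ fun hm => h ?_
    exact (AddCommGroup.modEq_iff_toIcoMod_eq_left Real.two_pi_pos).1 hm.symm
  have ht : Tendsto (fun s => toIcoMod Real.two_pi_pos 0 (b s - a s)) l
      (𝓝 (toIcoMod Real.two_pi_pos 0 (ψ - φ))) := hc.tendsto.comp (hb.sub ha)
  unfold ComparablePointers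
  rcases lt_trichotomy (toIcoMod Real.two_pi_pos 0 (ψ - φ)) Real.pi with hlt | heq | hgt
  · filter_upwards [ht.eventually_lt_const hlt, ht.eventually_const_lt hpos] with s h1 h2
    exact Or.inl ⟨hpos, hlt.le, h2, h1.le⟩
  · filter_upwards [ht.eventually_const_lt hpos] with s h2
    rcases le_total (toIcoMod Real.two_pi_pos 0 (b s - a s)) Real.pi with h3 | h3
    · exact Or.inl ⟨hpos, heq.le, h2, h3⟩
    · exact Or.inr ⟨heq.ge, h3⟩
  · filter_upwards [ht.eventually_const_lt hgt] with s h1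
    exact Or.inr ⟨hgt.le, h1.le⟩

theorem measureReal_subregion_sdiff_le {L : Plane → ℝ} {φ ψ φ' ψ' M Δ : ℝ} {r r' : Plane}
    (hM : 0 ≤ M) (hΔ : 0 ≤ Δ) (hr : ∀ q ∈ coverageRegion L, ‖q - r‖ ≤ M)
    (h : ComparablePointers φ ψ φ' ψ') (hφ : |φ - φ'| ≤ Δ) (hψ : |ψ - ψ'| ≤ Δ)
    (hrr : ‖r - r'‖ ≤ Δ) :
    volume.real (subregion L φ ψ r \ subregion L φ' ψ' r') ≤ 16 * M * (M + 1) * Δ := by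
  -- Each of the two strips has area at most 4M · 2(M + 1)Δ, whence the factor 16 in the bound.
  have hsub : subregion L φ ψ r \ subregion L φ' ψ' r' ⊆
      strip φ r M (2 * (M + 1) * Δ) ∪ strip ψ r M (2 * (M + 1) * Δ) := by
    rintro q ⟨⟨hqΩ, hq⟩, hq'⟩
    have hqM := hr q hqΩ
    have hle : ∀ {x : ℝ}, |x| ≤ Δ →
        2 * |x| * ‖q - r‖ + 2 * ‖r - r'‖ ≤ 2 * (M + 1) * Δ := fun {x} hx => by
      nlinarith [mul_le_mul hx hqM (norm_nonneg _) hΔ]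
    exact (near_boundary_of_mem_sector_of_notMem h hq fun h' => hq' ⟨hqΩ, h'⟩).imp
      (fun h => ⟨hqM, h.trans (hle hφ)⟩) (fun h => ⟨hqM, h.trans (hle hψ)⟩)
  have hle : volume (subregion L φ ψ r \ subregion L φ' ψ' r') ≤
      ENNReal.ofReal (16 * M * (M + 1) * Δ) := by
    refine (measure_mono hsub).trans <| (measure_union_le _ _).trans <|
      (add_le_add (volume_strip_le _ _ _ _ hM) (volume_strip_le _ _ _ _ hM)).trans ?_
    rw [← ENNReal.ofReal_add (by positivity) (by positivity)]
    exact ENNReal.ofReal_le_ofReal (le_of_eq (by ring))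
  exact ENNReal.toReal_le_of_le_ofReal (by positivity) hle

/-- The integral over a subregion is Lipschitz in the configuration of its pointers. -/
theorem norm_integral_subregion_sub_le {E : Type*} [NormedAddCommGroup E] [NormedSpace ℝ E]
    {L : Plane → ℝ} (hL : Continuous L) (hΩ : Bornology.IsBounded (coverageRegion L))
    {φ ψ φ' ψ' M Δ : ℝ} {r r' : Plane} (hM : 0 ≤ M) (hΔ : 0 ≤ Δ)
    (hr : ∀ q ∈ coverageRegion L, ‖q - r‖ ≤ M) (hr' : ∀ q ∈ coverageRegion L, ‖q - r'‖ ≤ M)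
    (h : ComparablePointers φ ψ φ' ψ') (hφ : |φ - φ'| ≤ Δ) (hψ : |ψ - ψ'| ≤ Δ)
    (hrr : ‖r - r'‖ ≤ Δ) {g : Plane → E} (hg : IntegrableOn g (coverageRegion L)) {C : ℝ}
    (hC0 : 0 ≤ C) (hC : ∀ q ∈ coverageRegion L, ‖g q‖ ≤ C) :
    ‖(∫ q in subregion L φ ψ r, g q) - ∫ q in subregion L φ' ψ' r', g q‖ ≤
      C * (32 * M * (M + 1)) * Δ := by
  have hfin : ∀ φ ψ r, volume (subregion L φ ψ r) < ⊤ := fun φ ψ r =>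
    (measure_mono Set.inter_subset_left).trans_lt (isCompact_coverageRegion hL hΩ).measure_lt_top
  refine (norm_setIntegral_sub_setIntegral_le (measurableSet_subregion hL φ ψ r)
    (measurableSet_subregion hL φ' ψ' r') (hg.mono_set Set.inter_subset_left)
    (hg.mono_set Set.inter_subset_left) (fun q hq => hC q hq.1) (fun q hq => hC q hq.1)
    (hfin _ _ _) (hfin _ _ _)).trans ?_
  have h1 := measureReal_subregion_sdiff_le hM hΔ hr h hφ hψ hrr
  have h2 := measureReal_subregion_sdiff_le hM hΔ hr' h.symm (by rwa [abs_sub_comm])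
    (by rwa [abs_sub_comm]) (by rwa [norm_sub_rev])
  nlinarith [mul_le_mul_of_nonneg_left h1 hC0, mul_le_mul_of_nonneg_left h2 hC0]

theorem volume_subregion_eq_zero_of_toIcoMod_eq_zero {L : Plane → ℝ}
    (hΩ : Bornology.IsBounded (coverageRegion L)) {φ ψ : ℝ} (r : Plane)
    (h : toIcoMod Real.two_pi_pos 0 (ψ - φ) = 0) : volume (subregion L φ ψ r) = 0 := by
  obtain ⟨M, hM⟩ := hΩ.subset_closedBall r
  have hsub : subregion L φ ψ r ⊆ strip φ r (max M 0) 0 := by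
    rintro q ⟨hqΩ, κ, α, h0, h1, h2, rfl⟩
    have : α = φ := by rw [h] at h2; linarith
    refine ⟨?_, ?_⟩
    · have := hM hqΩ
      rw [Metric.mem_closedBall, dist_eq_norm] at this
      exact this.trans (le_max_left _ _)
    · rw [add_sub_cancel_left, lineDist_smul_pointerDir, this]; simp
  refine le_antisymm ((measure_mono hsub).trans ?_) zero_le
  simpa using volume_strip_le φ r (max M 0) 0 (le_max_right _ _)

/-- At coinciding pointers the workload jumps, unless the coverage region is a null set. -/
theorem volume_coverageRegion_eq_zero_of_continuousAt {L ρ : Plane → ℝ} (hL : Continuous L)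
    (hΩ : Bornology.IsBounded (coverageRegion L)) {ρlow : ℝ} (hρpos : 0 < ρlow)
    (hρ : ∀ q ∈ coverageRegion L, ρlow ≤ ρ q) (hρi : IntegrableOn ρ (coverageRegion L))
    {φ ψ : ℝ} {r : Plane} (h : toIcoMod Real.two_pi_pos 0 (ψ - φ) = 0)
    (hcont : ContinuousAt (fun b => workload L ρ φ b r) ψ) : volume (coverageRegion L) = 0 := by
  have hpi := Real.two_le_pi
  -- Approaching ψ from below makes the opening angle wrap around to just under 2π: the sectors
  -- exhaust Ω, while the limiting sector is a ray.
  set u : ℕ → ℝ := fun n => ψ - 1 / ((n : ℝ) + 1) with hu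
  have hu1 : ∀ n : ℕ, 0 < 1 / ((n : ℝ) + 1) ∧ 1 / ((n : ℝ) + 1) ≤ 1 := fun n =>
    ⟨by positivity, by rw [div_le_one (by positivity)]; linarith [Nat.cast_nonneg (α := ℝ) n]⟩
  have hopen : ∀ n, toIcoMod Real.two_pi_pos 0 (u n - φ) = 2 * Real.pi - 1 / ((n : ℝ) + 1) := by
    intro n
    rw [toIcoMod_eq_iff]
    obtain ⟨k, hk⟩ := ((toIcoMod_eq_iff Real.two_pi_pos).1 h).2
    refine ⟨⟨by linarith [hu1 n], by linarith [hu1 n]⟩, k - 1, ?_⟩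
    rw [sub_smul, one_smul]
    simp only [hu]
    linarith
  have hut : Tendsto u atTop (𝓝 ψ) := by
    simpa [hu] using (tendsto_one_div_add_atTop_nhds_zero_nat (𝕜 := ℝ)).const_sub ψ
  have hmono : Monotone fun n => subregion L φ (u n) r := by
    intro m n hmn q hq
    refine ⟨hq.1, ?_⟩
    have hq2 := hq.2
    rcases eq_or_ne q r with rfl | hqr
    · exact apex_mem_sector _ _ _
    obtain ⟨τ, h0, h1, hτ⟩ := exists_polar φ (q - r)
    rw [mem_sector_iff_of_polar hqr h0 h1 hτ, hopen] at hq2 ⊢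
    linarith [one_div_le_one_div_of_le (by positivity : (0 : ℝ) < m + 1)
      (by exact_mod_cast Nat.add_le_add_right hmn 1 : (m : ℝ) + 1 ≤ n + 1)]
  have hunion : ⋃ n, subregion L φ (u n) r = coverageRegion L := by
    refine Set.Subset.antisymm (Set.iUnion_subset fun n => Set.inter_subset_left) fun q hq => ?_
    rcases eq_or_ne q r with rfl | hqr
    · exact Set.mem_iUnion.2 ⟨0, hq, apex_mem_sector _ _ _⟩
    obtain ⟨τ, h0, h1, hτ⟩ := exists_polar φ (q - r)
    obtain ⟨n, hn⟩ := exists_nat_one_div_lt (sub_pos.2 h1)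
    refine Set.mem_iUnion.2 ⟨n, hq, ?_⟩
    rw [mem_sector_iff_of_polar hqr h0 h1 hτ, hopen]
    linarith
  have hlim1 : Tendsto (fun n => workload L ρ φ (u n) r) atTop
      (𝓝 (∫ q in coverageRegion L, ρ q)) := by
    have := tendsto_setIntegral_of_monotone (μ := volume) (f := ρ)
      (fun n => measurableSet_subregion hL φ (u n) r) hmono (by rwa [hunion])
    rwa [hunion] at this
  have hlim2 := hcont.tendsto.comp hut
  have h0 : ∫ q in coverageRegion L, ρ q = 0 := by
    rw [tendsto_nhds_unique hlim1 hlim2]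
    exact setIntegral_measure_zero _ (volume_subregion_eq_zero_of_toIcoMod_eq_zero hΩ r h)
  -- The total mass vanishes, yet it is at least `ρlow` times the area.
  have hK := isCompact_coverageRegion hL hΩ
  have := setIntegral_ge_of_const_le_real hK.measurableSet hK.measure_lt_top.ne hρ hρi
  rw [h0] at this
  have hv : volume.real (coverageRegion L) = 0 :=
    le_antisymm (by by_contra! hc; linarith [mul_pos hρpos hc]) measureReal_nonneg
  exact (measureReal_eq_zero_iff hK.measure_lt_top.ne).1 hv

/-! ### Barbalat's lemma -/

/-- Barbalat's lemma for a function whose derivative is nonpositive. -/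
theorem tendsto_zero_of_hasDerivWithinAt_neg {V W : ℝ → ℝ} (hV0 : ∀ t, 0 ≤ t → 0 ≤ V t)
    (hW0 : ∀ t, 0 ≤ t → 0 ≤ W t)
    (hVW : ∀ t, 0 ≤ t → HasDerivWithinAt V (-W t) (Set.Ici 0) t)
    (hW : ∀ ε > 0, ∃ δ > 0, ∀ t, 0 ≤ t → ∀ s, 0 ≤ s → |s - t| < δ → |W s - W t| < ε) :
    Tendsto W atTop (𝓝 0) := by
  have hder : ∀ t, 0 < t → HasDerivAt V (-W t) t := fun t ht =>
    (hVW t ht.le).hasDerivAt (Ici_mem_nhds ht)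
  have hcont : ContinuousOn V (Set.Ici 0) := fun t ht => (hVW t ht).continuousWithinAt
  have hanti : AntitoneOn V (Set.Ici 0) := by
    refine antitoneOn_of_deriv_nonpos (convex_Ici 0) hcont ?_ ?_ <;> rw [interior_Ici] <;>
      intro t ht
    · exact (hder t ht).differentiableAt.differentiableWithinAt
    · rw [(hder t ht).deriv]
      linarith [hW0 t (le_of_lt ht)]
  obtain ⟨ℓ, hℓ⟩ : ∃ ℓ, Tendsto V atTop (𝓝 ℓ) := by
    -- Freezing V on negative times gives a globally antitone function, so monotone convergence
    -- applies.
    have h1 : Antitone fun t => V (max t 0) := fun s t hst =>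
      hanti (Set.mem_Ici.2 (le_max_right _ _)) (Set.mem_Ici.2 (le_max_right _ _))
        (max_le_max_right 0 hst)
    have h2 : BddBelow (Set.range fun t => V (max t 0)) := by
      refine ⟨0, ?_⟩
      rintro _ ⟨t, rfl⟩
      exact hV0 _ (le_max_right _ _)
    refine ⟨_, (tendsto_atTop_ciInf h1 h2).congr' ?_⟩
    filter_upwards [eventually_ge_atTop 0] with t ht
    rw [max_eq_left ht]
  rw [Metric.tendsto_atTop']
  intro ε hε
  obtain ⟨δ, hδ, hWδ⟩ := hW (ε / 2) (half_pos hε)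
  have hlim : Tendsto (fun t => V t - V (t + δ / 2)) atTop (𝓝 0) := by
    simpa using hℓ.sub (hℓ.comp (tendsto_atTop_add_const_right atTop (δ / 2) tendsto_id))
  have hev : ∀ᶠ t in atTop, V t - V (t + δ / 2) < ε / 2 * (δ / 2) :=
    hlim.eventually_lt_const (by positivity)
  obtain ⟨T, hT⟩ := (hev.and (eventually_ge_atTop 0)).exists_forall_of_atTop
  refine ⟨T, fun t ht => ?_⟩
  obtain ⟨h1, ht0⟩ := hT t ht.le
  rw [Real.dist_eq, sub_zero, abs_of_nonneg (hW0 t ht0)]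
  by_contra! hge
  -- If W t ≥ ε, then W ≥ ε/2 on the window of length δ/2, so V drops there by at least ε/2 · δ/2,
  -- contradicting convergence of V.
  obtain ⟨c, hc, hslope⟩ := exists_hasDerivAt_eq_slope V (fun s => -W s)
    (by linarith : t < t + δ / 2) (hcont.mono fun s hs => ht0.trans hs.1)
    fun s hs => hder s (ht0.trans_lt hs.1)
  have hWc := hWδ t ht0 c (ht0.trans hc.1.le) (by rw [abs_of_pos] <;> linarith [hc.1, hc.2])
  have : ε / 2 ≤ W c := by linarith [(abs_lt.1 hWc).1]
  rw [add_sub_cancel_left, eq_div_iff (by positivity)] at hslope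
  nlinarith

/-! ### The balancing energy and its gradient flow -/

section Flow

variable {N : ℕ} [NeZero N]

/-- The configuration `(φ_i, φ_{i+1}, r_i)` of one agent. -/
abbrev Config : Type := ℝ × ℝ × Plane

/-- The workload as a function of the configuration. -/
def configWorkload (L ρ : Plane → ℝ) (c : Config) : ℝ := workload L ρ c.1 c.2.1 c.2.2

/-- The gradient of `m` in the reference point. -/
def refGrad (m : Config → ℝ) (c : Config) : Plane :=
  (InnerProductSpace.toDual ℝ Plane).symm
    ((fderiv ℝ m c).comp ((ContinuousLinearMap.inr ℝ ℝ (ℝ × Plane)).comp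
      (ContinuousLinearMap.inr ℝ ℝ Plane)))

/-- The derivative of the balancing energy in the workload of agent `i`. -/
def imbalance (m : Config → ℝ) (X : Fin N → Config) (i : Fin N) : ℝ :=
  2 * m (X i) - m (X (i - 1)) - m (X (i + 1))

/-- The derivative of the balancing energy in the phase angle of agent `i`. -/
def phaseGrad (m : Config → ℝ) (X : Fin N → Config) (i : Fin N) : ℝ :=
  imbalance m X i * fderiv ℝ m (X i) (1, 0, 0)
    + imbalance m X (i - 1) * fderiv ℝ m (X (i - 1)) (0, 1, 0)

/-- The gradient of the balancing energy in the reference point of agent `i`. -/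
def pointGrad (m : Config → ℝ) (X : Fin N → Config) (i : Fin N) : Plane :=
  imbalance m X i • refGrad m (X i)
    + ((2 : ℝ) • (X i).2.2 - (X (i - 1)).2.2 - (X (i + 1)).2.2)

/-- The dissipation rate of the balancing energy along the gradient flow. -/
def dissipation (m : Config → ℝ) (kφ kr : ℝ) (X : Fin N → Config) : ℝ :=
  ∑ i, (kφ * phaseGrad m X i ^ 2 + kr * ‖pointGrad m X i‖ ^ 2)

/-- The balancing energy. -/
def balanceEnergy (m : Config → ℝ) (X : Fin N → Config) : ℝ :=
  ∑ i, (1 / 2 * (m (X i) - m (X (i - 1))) ^ 2 + 1 / 2 * ‖(X i).2.2 - (X (i - 1)).2.2‖ ^ 2)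

theorem fderiv_eq_add_inner_refGrad (m : Config → ℝ) (c : Config) (a b : ℝ) (v : Plane) :
    fderiv ℝ m c (a, b, v)
      = a * fderiv ℝ m c (1, 0, 0) + b * fderiv ℝ m c (0, 1, 0) + inner ℝ (refGrad m c) v := by
  have hv : inner ℝ (refGrad m c) v = fderiv ℝ m c (0, 0, v) := by
    rw [refGrad, InnerProductSpace.toDual_symm_apply]; simp
  have : ((a, b, v) : Config) = a • ((1, 0, 0) : Config) + b • ((0, 1, 0) : Config)
      + ((0, 0, v) : Config) := by simp
  rw [hv, this, map_add, map_add, map_smul, map_smul, smul_eq_mul, smul_eq_mul]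

theorem continuousAt_dissipation {m : Config → ℝ} {kφ kr : ℝ} {X : Fin N → Config}
    (h : ∀ i, ContDiffAt ℝ 1 m (X i)) : ContinuousAt (dissipation m kφ kr) X := by
  have hm : ∀ i, ContinuousAt (fun Y : Fin N → Config => m (Y i)) X := fun i =>
    ContinuousAt.comp (f := fun Y : Fin N → Config => Y i) (h i).continuousAt
      (continuous_apply i).continuousAt
  have hd : ∀ i, ContinuousAt (fun Y : Fin N → Config => fderiv ℝ m (Y i)) X := fun i =>
    ContinuousAt.comp (f := fun Y : Fin N → Config => Y i)
      ((h i).fderiv_right (m := 0) (by norm_num)).continuousAt (continuous_apply i).continuousAt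
  have hi : ∀ i, ContinuousAt (fun Y : Fin N → Config => imbalance m Y i) X := fun i =>
    ((continuousAt_const.mul (hm i)).sub (hm _)).sub (hm _)
  have hg : ∀ i, ContinuousAt (fun Y : Fin N → Config => refGrad m (Y i)) X := fun i =>
    (InnerProductSpace.toDual ℝ Plane).symm.continuous.continuousAt.comp
      ((hd i).clm_comp continuousAt_const)
  have hr : ∀ i, ContinuousAt (fun Y : Fin N → Config => (Y i).2.2) X := fun i =>
    (continuous_snd.comp (continuous_snd.comp (continuous_apply i))).continuousAt
  refine tendsto_finsetSum _ fun i _ => ?_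
  refine ContinuousAt.add (continuousAt_const.mul (ContinuousAt.pow ?_ 2))
    (continuousAt_const.mul (ContinuousAt.pow (ContinuousAt.norm ?_) 2))
  · exact ((hi i).mul ((hd i).clm_apply continuousAt_const)).add
      ((hi (i - 1)).mul ((hd (i - 1)).clm_apply continuousAt_const))
  · have h1 := (hi i).smul (hg i)
    have h2 := ((hr i).const_smul (2 : ℝ)).sub (hr (i - 1)) |>.sub (hr (i + 1))
    exact h1.add h2

/-- The dissipation rate is invariant under shifts of the phase angles by periods. -/
theorem dissipation_add {m : Config → ℝ} {kφ kr : ℝ} {v : Fin N → Config}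
    (hv : ∀ i, (v i).2.2 = 0) (hm : ∀ i c, m (c + v i) = m c) (X : Fin N → Config) :
    dissipation m kφ kr (X + v) = dissipation m kφ kr X := by
  have hd : ∀ i c, fderiv ℝ m (c + v i) = fderiv ℝ m c := fun i c => by
    rw [← fderiv_comp_add_right]; exact congrArg (fun g => fderiv ℝ g c) (funext (hm i))
  have hi : ∀ i, imbalance m (X + v) i = imbalance m X i := fun i => by
    simp [imbalance, hm]
  unfold dissipation
  refine Finset.sum_congr rfl fun i _ => ?_
  congr 3
  · simp [phaseGrad, hi, hd]
  · simp [pointGrad, hi, hd, hv, refGrad]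

/-- Summation by parts on the cycle; there are no boundary terms. -/
theorem sum_mul_sub_sub_one (a b : Fin N → ℝ) :
    ∑ i, (a i - a (i - 1)) * (b i - b (i - 1)) = ∑ i, (2 * a i - a (i - 1) - a (i + 1)) * b i := by
  have e : ∑ i, (a i - a (i - 1)) * b (i - 1) = ∑ i, (a (i + 1) - a i) * b i := by
    rw [← Equiv.sum_comp (Equiv.addRight (1 : Fin N))]
    simp
  simp only [mul_sub, Finset.sum_sub_distrib]
  rw [e, ← Finset.sum_sub_distrib]
  exact Finset.sum_congr rfl fun i _ => by ring

theorem sum_inner_sub_sub_one (a b : Fin N → Plane) :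
    ∑ i, inner ℝ (a i - a (i - 1)) (b i - b (i - 1))
      = ∑ i, inner ℝ ((2 : ℝ) • a i - a (i - 1) - a (i + 1)) (b i) := by
  have e : ∑ i, inner ℝ (a i - a (i - 1)) (b (i - 1))
      = ∑ i, inner ℝ (a (i + 1) - a i) (b i) := by
    rw [← Equiv.sum_comp (Equiv.addRight (1 : Fin N))]
    simp
  simp only [inner_sub_right, Finset.sum_sub_distrib]
  rw [e, ← Finset.sum_sub_distrib]
  refine Finset.sum_congr rfl fun i _ => ?_
  rw [← inner_sub_left]
  congr 1
  rw [two_smul]; abel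

/-- The balancing energy decreases at the dissipation rate along its gradient flow. -/
theorem hasDerivWithinAt_balanceEnergy {m : Config → ℝ} {kφ kr : ℝ} {S : Set ℝ} {t : ℝ}
    {X : ℝ → Fin N → Config} (hm : ∀ i, DifferentiableAt ℝ m (X t i))
    (hX : ∀ i, HasDerivWithinAt (fun s => X s i)
      (-kφ * phaseGrad m (X t) i, -kφ * phaseGrad m (X t) (i + 1), -kr • pointGrad m (X t) i)
      S t) :
    HasDerivWithinAt (fun s => balanceEnergy m (X s)) (-dissipation m kφ kr (X t)) S t := by
  set pv : Fin N → ℝ := fun i => -kφ * phaseGrad m (X t) i with hpv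
  set rv : Fin N → Plane := fun i => -kr • pointGrad m (X t) i with hrv
  set d : Fin N → ℝ := fun i => fderiv ℝ m (X t i) (pv i, pv (i + 1), rv i) with hd
  have h1 : ∀ i, HasDerivWithinAt (fun s => m (X s i)) (d i) S t := fun i =>
    (hm i).hasFDerivAt.comp_hasDerivWithinAt t (hX i)
  have h2 : ∀ i, HasDerivWithinAt (fun s => (X s i).2.2) (rv i) S t := fun i =>
    ((ContinuousLinearMap.snd ℝ ℝ Plane).comp
      (ContinuousLinearMap.snd ℝ ℝ (ℝ × Plane))).hasFDerivAt.comp_hasDerivWithinAt t (hX i)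
  have h3 : HasDerivWithinAt (fun s => balanceEnergy m (X s))
      (∑ i, ((m (X t i) - m (X t (i - 1))) * (d i - d (i - 1))
        + inner ℝ ((X t i).2.2 - (X t (i - 1)).2.2) (rv i - rv (i - 1)))) S t := by
    refine HasDerivWithinAt.fun_sum fun i _ => ?_
    refine ((((h1 i).sub (h1 (i - 1))).pow 2).const_mul (1 / 2)).add
      ((((h2 i).sub (h2 (i - 1))).norm_sq).const_mul (1 / 2)) |>.congr_deriv ?_
    simp; ring
  refine h3.congr_deriv ?_
  rw [Finset.sum_add_distrib, sum_mul_sub_sub_one, sum_inner_sub_sub_one]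
  have e : ∑ i, (2 * m (X t i) - m (X t (i - 1)) - m (X t (i + 1))) * d i
      = ∑ i, (pv i * phaseGrad m (X t) i
        + imbalance m (X t) i * inner ℝ (refGrad m (X t i)) (rv i)) := by
    -- The pointer φ_{i+1} bounds both m_i and m_{i+1}. Shifting the index collects both
    -- contributions under the agent that owns the pointer.
    have e1 : ∑ i, imbalance m (X t) i * (pv (i + 1) * fderiv ℝ m (X t i) (0, 1, 0))
        = ∑ i, imbalance m (X t) (i - 1) * (pv i * fderiv ℝ m (X t (i - 1)) (0, 1, 0)) := by
      rw [← Equiv.sum_comp (Equiv.subRight (1 : Fin N))]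
      simp
    simp only [hd, fderiv_eq_add_inner_refGrad m _ (pv _), mul_add, Finset.sum_add_distrib]
    rw [show ∑ i, (2 * m (X t i) - m (X t (i - 1)) - m (X t (i + 1))) *
        (pv (i + 1) * fderiv ℝ m (X t i) (0, 1, 0)) = _ from e1]
    rw [← Finset.sum_add_distrib, ← Finset.sum_add_distrib, ← Finset.sum_add_distrib]
    refine Finset.sum_congr rfl fun i _ => ?_
    simp only [phaseGrad, imbalance]
    ring
  rw [e, ← Finset.sum_add_distrib, dissipation, ← Finset.sum_neg_distrib]
  refine Finset.sum_congr rfl fun i _ => ?_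
  have e2 : imbalance m (X t) i * inner ℝ (refGrad m (X t i)) (rv i)
      + inner ℝ ((2 : ℝ) • (X t i).2.2 - (X t (i - 1)).2.2 - (X t (i + 1)).2.2) (rv i)
      = -kr * ‖pointGrad m (X t) i‖ ^ 2 := by
    rw [← real_inner_smul_left, ← inner_add_left, ← pointGrad, hrv, real_inner_smul_right,
      real_inner_self_eq_norm_sq]
  rw [add_assoc, e2, hpv]
  ring

theorem mul_sq_phaseGrad_le_dissipation {m : Config → ℝ} {kφ kr : ℝ} (hφ : 0 ≤ kφ) (hr : 0 ≤ kr)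
    (X : Fin N → Config) (i : Fin N) : kφ * phaseGrad m X i ^ 2 ≤ dissipation m kφ kr X := by
  refine le_trans ?_ (Finset.single_le_sum (f := fun i => kφ * phaseGrad m X i ^ 2
    + kr * ‖pointGrad m X i‖ ^ 2) (fun j _ => by positivity) (Finset.mem_univ i))
  have : 0 ≤ kr * ‖pointGrad m X i‖ ^ 2 := by positivity
  simpa using this

theorem mul_sq_pointGrad_le_dissipation {m : Config → ℝ} {kφ kr : ℝ} (hφ : 0 ≤ kφ) (hr : 0 ≤ kr)
    (X : Fin N → Config) (i : Fin N) : kr * ‖pointGrad m X i‖ ^ 2 ≤ dissipation m kφ kr X := by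
  refine le_trans ?_ (Finset.single_le_sum (f := fun i => kφ * phaseGrad m X i ^ 2
    + kr * ‖pointGrad m X i‖ ^ 2) (fun j _ => by positivity) (Finset.mem_univ i))
  have : 0 ≤ kφ * phaseGrad m X i ^ 2 := by positivity
  simpa using this

theorem norm_le_sqrt_of_mul_sq_le {E : Type*} [SeminormedAddCommGroup E] {x : E} {k D : ℝ}
    (hk : 0 < k) (h : k * ‖x‖ ^ 2 ≤ D) : ‖x‖ ≤ Real.sqrt (D / k) :=
  Real.le_sqrt_of_sq_le (by rw [le_div_iff₀ hk]; linarith)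

/-- The velocity of a configuration is controlled by the dissipation rate. -/
theorem norm_velocity_le {m : Config → ℝ} {kφ kr : ℝ} (hφ : 0 < kφ) (hr : 0 < kr)
    (X : Fin N → Config) (i : Fin N) {D : ℝ} (hD : dissipation m kφ kr X ≤ D) :
    ‖((-kφ * phaseGrad m X i, -kφ * phaseGrad m X (i + 1), -kr • pointGrad m X i) : Config)‖
      ≤ kφ * Real.sqrt (D / kφ) + kr * Real.sqrt (D / kr) := by
  have h1 : ∀ j, ‖-kφ * phaseGrad m X j‖ ≤ kφ * Real.sqrt (D / kφ) := fun j => by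
    rw [norm_mul, norm_neg, Real.norm_of_nonneg hφ.le]
    refine mul_le_mul_of_nonneg_left (norm_le_sqrt_of_mul_sq_le hφ ?_) hφ.le
    rw [Real.norm_eq_abs, sq_abs]
    exact (mul_sq_phaseGrad_le_dissipation hφ.le hr.le X j).trans hD
  have h2 : ‖-kr • pointGrad m X i‖ ≤ kr * Real.sqrt (D / kr) := by
    rw [norm_smul, norm_neg, Real.norm_of_nonneg hr.le]
    exact mul_le_mul_of_nonneg_left (norm_le_sqrt_of_mul_sq_le hr
      ((mul_sq_pointGrad_le_dissipation hφ.le hr.le X i).trans hD)) hr.le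
  have h3 : 0 ≤ kφ * Real.sqrt (D / kφ) := by positivity
  have h4 : 0 ≤ kr * Real.sqrt (D / kr) := by positivity
  exact norm_prod_le_iff.2 ⟨(h1 i).trans (by linarith),
    norm_prod_le_iff.2 ⟨(h1 (i + 1)).trans (by linarith), h2.trans (by linarith)⟩⟩

/-- Along the gradient flow of the balancing energy the dissipation rate vanishes in the limit, if
the configurations stay in a compact set modulo periods of the workload. -/
theorem tendsto_dissipation {m : Config → ℝ} {kφ kr : ℝ} (hφ : 0 < kφ) (hr : 0 < kr)
    {K : Set Config} (hK : IsCompact K) (hmK : ∀ c ∈ K, ContDiffAt ℝ 1 m c)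
    {X : ℝ → Fin N → Config}
    (hper : ∀ t, 0 ≤ t → ∀ i, ∃ v : Config, v.2.2 = 0 ∧ (∀ c, m (c + v) = m c) ∧ X t i + v ∈ K)
    (hX : ∀ t, 0 ≤ t → ∀ i, HasDerivWithinAt (fun s => X s i)
      (-kφ * phaseGrad m (X t) i, -kφ * phaseGrad m (X t) (i + 1), -kr • pointGrad m (X t) i)
      (Set.Ici 0) t) :
    Tendsto (fun t => dissipation m kφ kr (X t)) atTop (𝓝 0) := by
  have hKN : IsCompact (Set.univ.pi fun _ : Fin N => K) := isCompact_univ_pi fun _ => hK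
  have hcont : ∀ Y ∈ Set.univ.pi fun _ : Fin N => K, ContinuousAt (dissipation m kφ kr) Y :=
    fun Y hY => continuousAt_dissipation fun i => hmK _ (hY i trivial)
  have hper' : ∀ t, 0 ≤ t → ∃ v : Fin N → Config,
      (∀ Y, dissipation m kφ kr (Y + v) = dissipation m kφ kr Y) ∧
      X t + v ∈ Set.univ.pi fun _ : Fin N => K := by
    intro t ht
    choose v h1 h2 h3 using hper t ht
    exact ⟨v, fun Y => dissipation_add h1 h2 Y, fun i _ => h3 i⟩
  obtain ⟨D, hD⟩ := hKN.exists_bound_of_continuousOn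
    fun Y hY => (hcont Y hY).continuousWithinAt
  have hDt : ∀ t, 0 ≤ t → dissipation m kφ kr (X t) ≤ D := by
    intro t ht
    obtain ⟨v, hv, hvK⟩ := hper' t ht
    rw [← hv]
    exact (le_abs_self _).trans (hD _ hvK)
  set C := kφ * Real.sqrt (D / kφ) + kr * Real.sqrt (D / kr) with hC
  have hC0 : 0 ≤ C := by positivity
  have hlip : ∀ t, 0 ≤ t → ∀ s, 0 ≤ s → dist (X t) (X s) ≤ C * |s - t| := by
    intro t ht s hs
    rw [dist_comm, dist_pi_le_iff (by positivity)]
    intro i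
    rw [dist_eq_norm]
    exact Convex.norm_image_sub_le_of_norm_hasDerivWithin_le (fun u hu => hX u hu i)
      (fun u hu => norm_velocity_le hφ hr (X u) i (hDt u hu)) (convex_Ici 0) ht hs
  refine tendsto_zero_of_hasDerivWithinAt_neg (V := fun t => balanceEnergy m (X t)) ?_ ?_ ?_ ?_
  · intro t _
    exact Finset.sum_nonneg fun i _ => by positivity
  · intro t _
    exact Finset.sum_nonneg fun i _ => by positivity
  · intro t ht
    refine hasDerivWithinAt_balanceEnergy (fun i => ?_) (hX t ht)
    obtain ⟨v, -, hv, hvK⟩ := hper t ht i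
    -- Only a translate of the configuration lies in K; periodicity of m carries differentiability
    -- back.
    have := ((hmK _ hvK).differentiableAt (by norm_num)).comp (X t i)
      ((differentiableAt_id).add_const v)
    exact this.congr_of_eventuallyEq (Eventually.of_forall fun c => (hv c).symm)
  · intro ε hε
    -- The shift v chosen at time t is also used at time s, and X s + v may leave K. Continuity at
    -- the points of K in the full space yields a uniform estimate against such nearby points.
    have h1 := hKN.uniformContinuousAt_of_continuousAt _ hcont (Metric.dist_mem_uniformity hε)
    obtain ⟨δ, hδ, h2⟩ := Metric.mem_uniformity_dist.1 h1
    refine ⟨δ / (C + 1), by positivity, fun t ht s hs hst => ?_⟩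
    obtain ⟨v, hv, hvK⟩ := hper' t ht
    have hd : dist (X t + v) (X s + v) < δ := by
      rw [dist_add_right]
      refine (hlip t ht s hs).trans_lt ?_
      rw [lt_div_iff₀ (by positivity)] at hst
      nlinarith [abs_nonneg (s - t)]
    have := h2 hd hvK
    simp only [Set.mem_ofPred_eq, hv] at this
    rwa [dist_comm] at this

end Flow

/-! ### Limits of linear systems and of difference quotients -/

theorem Matrix.det_ne_zero_of_rank_eq_card {n : Type*} [Fintype n] [DecidableEq n]
    {K : Type*} [Field K] {A : Matrix n n K} (h : A.rank = Fintype.card n) : A.det ≠ 0 := by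
  have h1 : LinearIndependent K A.row := by
    rw [linearIndependent_iff_card_eq_finrank_span, ← h, Matrix.rank_eq_finrank_span_row]
    rfl
  exact ((Matrix.isUnit_iff_isUnit_det A).1
    (Matrix.linearIndependent_rows_iff_isUnit.1 h1)).ne_zero

/-- If the matrices `M` stay in a compact set and all their accumulation points are invertible,
then `v ᵥ* M → 0` implies `v → 0`. -/
theorem tendsto_zero_of_tendsto_vecMul {n ι : Type*} [Fintype n] [DecidableEq n] {l : Filter ι}
    {M : ι → Matrix n n ℝ} {v : ι → n → ℝ} {S : Set (Matrix n n ℝ)} (hS : IsCompact S)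
    (hMS : ∀ᶠ t in l, M t ∈ S) (hM : ∀ H, MapClusterPt H l M → H.det ≠ 0)
    (hv : Tendsto (fun t => Matrix.vecMul (v t) (M t)) l (𝓝 0)) : Tendsto v l (𝓝 0) := by
  -- Ultrafilters play the role of convergent subsequences. Along each one M has an invertible
  -- limit, and v = (det M)⁻¹ (v M) adj M passes to the limit.
  rw [tendsto_iff_ultrafilter]
  intro U hU
  obtain ⟨H, -, hH⟩ := hS.ultrafilter_le_nhds' (U.map M) (hU hMS)
  have hMH : Tendsto M U (𝓝 H) := hH
  have hdet : H.det ≠ 0 := hM H (mapClusterPt_iff_ultrafilter.2 ⟨U, hU, hMH⟩)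
  have hdetM : Tendsto (fun t => (M t).det) U (𝓝 H.det) :=
    (Continuous.matrix_det continuous_id).continuousAt.tendsto.comp hMH
  have hadj : Tendsto (fun t => (M t).adjugate) U (𝓝 H.adjugate) :=
    (Continuous.matrix_adjugate continuous_id).continuousAt.tendsto.comp hMH
  have hc : Continuous fun z : (n → ℝ) × Matrix n n ℝ => Matrix.vecMul z.1 z.2 :=
    continuous_fst.matrix_vecMul continuous_snd
  have h1 : Tendsto (fun t => Matrix.vecMul (Matrix.vecMul (v t) (M t)) (M t).adjugate) U
      (𝓝 0) := by
    have := (hc.tendsto ((0 : n → ℝ), H.adjugate)).comp ((hv.mono_left hU).prodMk_nhds hadj)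
    simpa only [Matrix.zero_vecMul, Function.comp_def] using this
  have h2 : Tendsto (fun t => (M t).det⁻¹ •
      Matrix.vecMul (Matrix.vecMul (v t) (M t)) (M t).adjugate) U (𝓝 0) := by
    simpa only [smul_zero] using (hdetM.inv₀ hdet).smul h1
  refine h2.congr' ?_
  filter_upwards [hdetM.eventually_ne hdet] with t ht
  rw [Matrix.vecMul_vecMul, Matrix.mul_adjugate, Matrix.vecMul_smul, Matrix.vecMul_one,
    smul_smul, inv_mul_cancel₀ ht, one_smul]

/-- Local domination of increments passes to the derivatives. -/
theorem norm_deriv_le_of_eventually_norm_sub_le {E F : Type*} [NormedAddCommGroup E]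
    [NormedSpace ℝ E] [NormedAddCommGroup F] [NormedSpace ℝ F] {u : ℝ → E} {v : ℝ → F} {u' : E}
    {v' : F} {t C : ℝ} (hu : HasDerivAt u u' t) (hv : HasDerivAt v v' t)
    (h : ∀ᶠ s in 𝓝 t, ‖u s - u t‖ ≤ C * ‖v s - v t‖) : ‖u'‖ ≤ C * ‖v'‖ := by
  refine le_of_tendsto_of_tendsto hu.tendsto_slope.norm (hv.tendsto_slope.norm.const_mul C) ?_
  filter_upwards [nhdsWithin_le_nhds h] with s hs
  rw [slope_def_module, slope_def_module, norm_smul, norm_smul, mul_left_comm]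
  exact mul_le_mul_of_nonneg_left hs (norm_nonneg _)

/-! ### The partition dynamics as the gradient flow -/

section Dynamics

variable {N : ℕ} [NeZero N]

/-- The configurations of all agents. -/
def agentConfig (φ : Fin N → ℝ) (r : Fin N → Plane) (i : Fin N) : Config :=
  (φ i, φ (i + 1), r i)

theorem workloadDerivOwn_eq {L ρ : Plane → ℝ} {φ : Fin N → ℝ} {r : Fin N → Plane} {i : Fin N}
    (h : DifferentiableAt ℝ (configWorkload L ρ) (agentConfig φ r i)) :
    workloadDerivOwn L ρ φ r i
      = fderiv ℝ (configWorkload L ρ) (agentConfig φ r i) (1, 0, 0) :=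
  (HasFDerivAt.comp_hasDerivAt (φ i) (f := fun a => ((a, φ (i + 1), r i) : Config)) h.hasFDerivAt
    ((hasDerivAt_id (φ i)).prodMk (hasDerivAt_const (φ i) (φ (i + 1), r i)))).deriv

theorem workloadDerivNext_eq {L ρ : Plane → ℝ} {φ : Fin N → ℝ} {r : Fin N → Plane} {i : Fin N}
    (h : DifferentiableAt ℝ (configWorkload L ρ) (agentConfig φ r i)) :
    workloadDerivNext L ρ φ r i
      = fderiv ℝ (configWorkload L ρ) (agentConfig φ r i) (0, 1, 0) :=
  (HasFDerivAt.comp_hasDerivAt (φ (i + 1)) (f := fun b => ((φ i, b, r i) : Config)) h.hasFDerivAt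
    ((hasDerivAt_const (φ (i + 1)) (φ i)).prodMk
      ((hasDerivAt_id (φ (i + 1))).prodMk (hasDerivAt_const (φ (i + 1)) (r i))))).deriv

theorem workloadGradRef_eq {L ρ : Plane → ℝ} {φ : Fin N → ℝ} {r : Fin N → Plane} {i : Fin N}
    (h : DifferentiableAt ℝ (configWorkload L ρ) (agentConfig φ r i)) :
    workloadGradRef L ρ φ r i = refGrad (configWorkload L ρ) (agentConfig φ r i) := by
  have h1 : HasFDerivAt (fun x : Plane => ((φ i, φ (i + 1), x) : Config))
      ((ContinuousLinearMap.inr ℝ ℝ (ℝ × Plane)).comp (ContinuousLinearMap.inr ℝ ℝ Plane))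
      (r i) :=
    (hasFDerivAt_prodMk_right (φ i) (φ (i + 1), r i)).comp (r i)
      (hasFDerivAt_prodMk_right (φ (i + 1)) (r i))
  have h2 := (HasFDerivAt.comp (r i) (f := fun x : Plane => ((φ i, φ (i + 1), x) : Config))
    h.hasFDerivAt h1).fderiv
  rw [workloadGradRef, gradient, refGrad, ← h2]
  rfl

theorem phaseField_eq {L ρ : Plane → ℝ} {kφ : ℝ} {φ : Fin N → ℝ} {r : Fin N → Plane}
    (h : ∀ i, DifferentiableAt ℝ (configWorkload L ρ) (agentConfig φ r i)) (i : Fin N) :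
    phaseField L ρ kφ φ r i
      = -kφ * phaseGrad (configWorkload L ρ) (agentConfig φ r) i := by
  -- The numeral 2 is reduced modulo N, so this also covers N = 1.
  have e : i - 2 = i - 1 - 1 := by
    rw [sub_sub]
    congr 1
    ext
    simp [Fin.val_add]
  rw [phaseField, workloadDerivOwn_eq (h i), workloadDerivNext_eq (h (i - 1)), phaseGrad,
    imbalance, imbalance, e, sub_add_cancel]
  rfl

theorem refField_eq {L ρ : Plane → ℝ} {kr : ℝ} {φ : Fin N → ℝ} {r : Fin N → Plane}
    (h : ∀ i, DifferentiableAt ℝ (configWorkload L ρ) (agentConfig φ r i)) (i : Fin N) :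
    refField L ρ kr φ r i = -kr • pointGrad (configWorkload L ρ) (agentConfig φ r) i := by
  rw [refField, workloadGradRef_eq (h i)]
  rfl

theorem configWorkload_add_period (L ρ : Plane → ℝ) (k l : ℤ) (c : Config) :
    configWorkload L ρ (c + ((k * (2 * Real.pi), l * (2 * Real.pi), 0) : Config))
      = configWorkload L ρ c := by
  simp [configWorkload, workload, subregion, sector_add_int_mul_two_pi]

theorem StaysInRegularCompact.differentiableAt {L ρ : Plane → ℝ} {φ : Fin N → ℝ → ℝ}
    {r : Fin N → ℝ → Plane} (h : StaysInRegularCompact L ρ φ r) {t : ℝ} (ht : 0 ≤ t)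
    (i : Fin N) :
    DifferentiableAt ℝ (configWorkload L ρ)
      (agentConfig (fun j => φ j t) (fun j => r j t) i) := by
  obtain ⟨K, -, hmK, hK⟩ := h
  obtain ⟨k, l, hkl⟩ := hK t ht i
  set v : Config := (k * (2 * Real.pi), l * (2 * Real.pi), 0)
  have hmem : agentConfig (fun j => φ j t) (fun j => r j t) i + v ∈ K := by
    simpa [agentConfig, v] using hkl
  have := ((hmK _ hmem).differentiableAt (by norm_num)).comp
    (agentConfig (fun j => φ j t) (fun j => r j t) i) (differentiableAt_id.add_const v)
  exact this.congr_of_eventuallyEq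
    (Eventually.of_forall fun c => (configWorkload_add_period L ρ k l c).symm)

/-- The velocity of the configuration of agent `i` along the partition dynamics. -/
def configVelocity (L ρ : Plane → ℝ) (kφ kr : ℝ) (φ : Fin N → ℝ) (r : Fin N → Plane)
    (i : Fin N) : Config :=
  (phaseField L ρ kφ φ r i, phaseField L ρ kφ φ r (i + 1), refField L ρ kr φ r i)

theorem SolvesPartitionDynamics.hasDerivWithinAt {L ρ : Plane → ℝ} {kφ kr : ℝ}
    {φ : Fin N → ℝ → ℝ} {r : Fin N → ℝ → Plane} (hsol : SolvesPartitionDynamics L ρ kφ kr φ r)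
    {t : ℝ} (ht : 0 ≤ t) (i : Fin N) :
    HasDerivWithinAt (fun s => agentConfig (fun j => φ j s) (fun j => r j s) i)
      (configVelocity L ρ kφ kr (fun j => φ j t) (fun j => r j t) i) (Set.Ici 0) t :=
  (hsol t ht i).1.prodMk ((hsol t ht (i + 1)).1.prodMk (hsol t ht i).2)

/-- The partition dynamics come to rest. -/
theorem tendsto_configVelocity {L ρ : Plane → ℝ} {kφ kr : ℝ} (hkφ : 0 < kφ) (hkr : 0 < kr)
    {φ : Fin N → ℝ → ℝ} {r : Fin N → ℝ → Plane} (hsol : SolvesPartitionDynamics L ρ kφ kr φ r)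
    (hreg : StaysInRegularCompact L ρ φ r) (i : Fin N) :
    Tendsto (fun t => configVelocity L ρ kφ kr (fun j => φ j t) (fun j => r j t) i) atTop
      (𝓝 0) := by
  set X : ℝ → Fin N → Config := fun t => agentConfig (fun j => φ j t) (fun j => r j t) with hX
  have hvel : ∀ t, 0 ≤ t → ∀ i,
      configVelocity L ρ kφ kr (fun j => φ j t) (fun j => r j t) i =
        (-kφ * phaseGrad (configWorkload L ρ) (X t) i,
          -kφ * phaseGrad (configWorkload L ρ) (X t) (i + 1),
          -kr • pointGrad (configWorkload L ρ) (X t) i) := by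
    intro t ht i
    have hd := fun i => hreg.differentiableAt ht i
    rw [configVelocity, phaseField_eq hd, phaseField_eq hd, refField_eq hd]
  have hdiss : Tendsto (fun t => dissipation (configWorkload L ρ) kφ kr (X t)) atTop (𝓝 0) := by
    obtain ⟨K, hKc, hmK, hK⟩ := hreg
    refine tendsto_dissipation (m := configWorkload L ρ) hkφ hkr hKc hmK ?_ fun t ht i => ?_
    · intro t ht i
      obtain ⟨k, l, hkl⟩ := hK t ht i
      exact ⟨(k * (2 * Real.pi), l * (2 * Real.pi), 0), rfl,
        configWorkload_add_period L ρ k l, by simpa [hX, agentConfig] using hkl⟩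
    · rw [← hvel t ht i]
      exact hsol.hasDerivWithinAt ht i
  -- The velocity bound is now applied with the instantaneous dissipation rate instead of a uniform
  -- bound on it.
  have hbound : Tendsto (fun t => kφ * Real.sqrt (dissipation (configWorkload L ρ) kφ kr (X t) / kφ)
      + kr * Real.sqrt (dissipation (configWorkload L ρ) kφ kr (X t) / kr)) atTop (𝓝 0) := by
    have := ((hdiss.div_const kφ).sqrt.const_mul kφ).add ((hdiss.div_const kr).sqrt.const_mul kr)
    simpa using this
  refine squeeze_zero_norm' ?_ hbound
  filter_upwards [eventually_ge_atTop 0] with t ht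
  rw [hvel t ht i]
  exact norm_velocity_le hkφ hkr (X t) i le_rfl

end Dynamics

/-! ### Derivatives of the local cost -/

section Cost

variable {L ρ : Plane → ℝ} {f : Plane → Plane → ℝ} {R : ℝ}

theorem localCost_eq (φ ψ : ℝ) (r : Plane) :
    localCost L ρ f φ ψ r = fun p => ∫ q in subregion L φ ψ r, ρ q • f p q := by
  funext p
  simp [localCost, mul_comm]

theorem fderiv_localCost (hL : Continuous L) (hΩ : Bornology.IsBounded (coverageRegion L))
    (hρ : ∀ q ∈ coverageRegion L, |ρ q| ≤ R)
    (hρmeas : AEStronglyMeasurable ρ (volume.restrict (coverageRegion L)))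
    (hf : ∀ q ∈ coverageRegion L, ContDiff ℝ 2 (fun p => f p q))
    (hf0 : ContinuousOn (fun z : Plane × Plane => f z.1 z.2) (Set.univ ×ˢ coverageRegion L))
    (hf1 : ContinuousOn (fun z : Plane × Plane => fderiv ℝ (fun p => f p z.2) z.1)
      (Set.univ ×ˢ coverageRegion L)) (φ ψ : ℝ) (r : Plane) :
    fderiv ℝ (localCost L ρ f φ ψ r)
      = fun p => ∫ q in subregion L φ ψ r, ρ q • fderiv ℝ (fun p => f p q) p := by
  funext p
  rw [localCost_eq]
  exact (hasFDerivAt_setIntegral_smul (isCompact_coverageRegion hL hΩ)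
    (measurableSet_subregion hL φ ψ r) Set.inter_subset_left hρ hρmeas
    (D := fun p q => fderiv ℝ (fun p => f p q) p) hf0 hf1
    (fun q hq p => ((hf q hq).differentiable (by norm_num) p).hasFDerivAt) p).fderiv

theorem hasFDerivAt_fderiv_localCost (hL : Continuous L)
    (hΩ : Bornology.IsBounded (coverageRegion L)) (hρ : ∀ q ∈ coverageRegion L, |ρ q| ≤ R)
    (hρmeas : AEStronglyMeasurable ρ (volume.restrict (coverageRegion L)))
    (hf : ∀ q ∈ coverageRegion L, ContDiff ℝ 2 (fun p => f p q))
    (hf0 : ContinuousOn (fun z : Plane × Plane => f z.1 z.2) (Set.univ ×ˢ coverageRegion L))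
    (hf1 : ContinuousOn (fun z : Plane × Plane => fderiv ℝ (fun p => f p z.2) z.1)
      (Set.univ ×ˢ coverageRegion L))
    (hf2 : ContinuousOn (fun z : Plane × Plane => fderiv ℝ (fderiv ℝ (fun p => f p z.2)) z.1)
      (Set.univ ×ˢ coverageRegion L)) (φ ψ : ℝ) (r p : Plane) :
    HasFDerivAt (fderiv ℝ (localCost L ρ f φ ψ r))
      (∫ q in subregion L φ ψ r, ρ q • fderiv ℝ (fderiv ℝ (fun p => f p q)) p) p := by
  rw [fderiv_localCost hL hΩ hρ hρmeas hf hf0 hf1]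
  exact hasFDerivAt_setIntegral_smul (isCompact_coverageRegion hL hΩ)
    (measurableSet_subregion hL φ ψ r) Set.inter_subset_left hρ hρmeas
    (F := fun p q => fderiv ℝ (fun p => f p q) p)
    (D := fun p q => fderiv ℝ (fderiv ℝ (fun p => f p q)) p) hf1 hf2
    (fun q hq p => (((hf q hq).fderiv_right (m := 1) (by norm_num)).differentiable
      (by norm_num) p).hasFDerivAt) p

theorem hessianMatrix_localCost_eq_zero (h : volume (coverageRegion L) = 0) (φ ψ : ℝ)
    (r p : Plane) : hessianMatrix (localCost L ρ f φ ψ r) p = 0 := by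
  have : localCost L ρ f φ ψ r = fun _ => 0 := by
    funext p
    exact setIntegral_measure_zero _ (measure_mono_null Set.inter_subset_left h)
  ext a b
  simp [hessianMatrix, this]

/-- Links the matrix in the rank hypotheses to the second derivative applied to the velocity. -/
theorem vecMul_hessianMatrix (J : Plane → ℝ) (p v : Plane) (b : Fin 2) :
    Matrix.vecMul (fun a => v a) (hessianMatrix J p) b
      = fderiv ℝ (fderiv ℝ J) p v (EuclideanSpace.single b 1) := by
  have hv : v = v 0 • EuclideanSpace.single 0 1 + v 1 • EuclideanSpace.single 1 1 := by
    ext j; fin_cases j <;> simp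
  conv_rhs => rw [hv]
  simp [Matrix.vecMul, dotProduct, hessianMatrix]

theorem abs_apply_single_le (T : Plane →L[ℝ] Plane →L[ℝ] ℝ) (v : Plane) (b : Fin 2) :
    |T v (EuclideanSpace.single b 1)| ≤ ‖T v‖ := by
  simpa using (T v).le_opNorm (EuclideanSpace.single b 1)

end Cost

end

/-! ### The optimal position comes to rest -/

set_option maxSynthPendingDepth 3 in
theorem lemma3
    {N : ℕ} [NeZero N]
    -- the coverage region
    (L : Plane → ℝ) (hL : Continuous L) (hΩ : Bornology.IsBounded (coverageRegion L))
    -- the density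
    (ρ : Plane → ℝ) (ρlow ρhigh : ℝ) (hρpos : 0 < ρlow)
    (hρ : ∀ q ∈ coverageRegion L, ρlow ≤ ρ q ∧ ρ q ≤ ρhigh)
    (hρmeas : AEStronglyMeasurable ρ (volume.restrict (coverageRegion L)))
    -- the service cost, twice continuously differentiable in the position of the agent
    (f : Plane → Plane → ℝ)
    (hf : ∀ q ∈ coverageRegion L, ContDiff ℝ 2 (fun p => f p q))
    (hf0 : ContinuousOn (fun z : Plane × Plane => f z.1 z.2)
      (Set.univ ×ˢ coverageRegion L))
    (hf1 : ContinuousOn (fun z : Plane × Plane => fderiv ℝ (fun p => f p z.2) z.1)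
      (Set.univ ×ˢ coverageRegion L))
    (hf2 : ContinuousOn
      (fun z : Plane × Plane => fderiv ℝ (fderiv ℝ (fun p => f p z.2)) z.1)
      (Set.univ ×ˢ coverageRegion L))
    -- the partition dynamics
    (kφ kr : ℝ) (hkφ : 0 < kφ) (hkr : 0 < kr)
    (φ : Fin N → ℝ → ℝ) (r : Fin N → ℝ → Plane)
    (hsol : SolvesPartitionDynamics L ρ kφ kr φ r)
    (hreg : StaysInRegularCompact L ρ φ r)
    -- the optimal positions, differentiable in time
    (pstar : Fin N → ℝ → Plane) :
    ∀ i : Fin N,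
      (∀ t : ℝ, 0 ≤ t →
        IsOptimalPosition L ρ f (φ i t) (φ (i + 1) t) (r i t) (pstar i t)) →
      DifferentiableOn ℝ (pstar i) (Set.Ici 0) →
      -- full rank of the Hessian at the optimal position, at all times and in the limit
      (∀ t : ℝ, 0 ≤ t → (agentHessian L ρ f φ r i t (pstar i t)).rank = 2) →
      (∀ H : Matrix (Fin 2) (Fin 2) ℝ,
        MapClusterPt H atTop (fun t => agentHessian L ρ f φ r i t (pstar i t)) →
        H.rank = 2) →
      Tendsto (fun t => deriv (pstar i) t) atTop (𝓝 0) := by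
  intro i hopt hdiff hrank hcluster
  have hK := isCompact_coverageRegion hL hΩ
  have hfin : volume (coverageRegion L) < ⊤ := hK.measure_lt_top
  set R := |ρhigh| with hR
  have hρR : ∀ q ∈ coverageRegion L, |ρ q| ≤ R := fun q hq => by
    rw [abs_of_pos (hρpos.trans_le (hρ q hq).1)]
    exact (hρ q hq).2.trans (le_abs_self _)
  have hρi : IntegrableOn ρ (coverageRegion L) := by
    simpa using integrableOn_smul_of_continuousOn hK hρR hρmeas
      (continuousOn_const (c := (1 : ℝ)))
  have hsub : coverageRegion L ×ˢ coverageRegion L ⊆ Set.univ ×ˢ coverageRegion L :=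
    Set.prod_mono (Set.subset_univ _) subset_rfl
  -- Bounds on Ω × Ω suffice, because the optimal positions stay in Ω.
  obtain ⟨B₁, hB₁⟩ := (hK.prod hK).exists_bound_of_continuousOn (hf1.mono hsub)
  obtain ⟨B₂, hB₂⟩ := (hK.prod hK).exists_bound_of_continuousOn (hf2.mono hsub)
  have hpΩ : ∀ t, 0 ≤ t → pstar i t ∈ coverageRegion L := fun t ht => (hopt t ht).1.1.1
  have hB₁0 : 0 ≤ B₁ :=
    (norm_nonneg _).trans (hB₁ (pstar i 0, pstar i 0) ⟨hpΩ 0 le_rfl, hpΩ 0 le_rfl⟩)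
  -- all reference points are at a bounded distance from the coverage region
  obtain ⟨M, hM0, hM⟩ : ∃ M, 0 ≤ M ∧ ∀ t, 0 ≤ t → ∀ q ∈ coverageRegion L, ‖q - r i t‖ ≤ M := by
    obtain ⟨K, hKc, -, hKmem⟩ := hreg
    obtain ⟨M₁, hM₁⟩ := hKc.isBounded.exists_norm_le
    obtain ⟨M₂, hM₂⟩ := hΩ.exists_norm_le
    have hle : ∀ t, 0 ≤ t → ∀ q ∈ coverageRegion L, ‖q - r i t‖ ≤ M₂ + M₁ := by
      intro t ht q hq
      obtain ⟨k, l, hkl⟩ := hKmem t ht i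
      have h1 := hM₁ _ hkl
      have h2 : ‖r i t‖ ≤ M₁ := (norm_snd_le _).trans ((norm_snd_le _).trans h1)
      exact (norm_sub_le _ _).trans (add_le_add (hM₂ q hq) h2)
    exact ⟨M₂ + M₁, (norm_nonneg _).trans (hle 0 le_rfl _ (hpΩ 0 le_rfl)), hle⟩
  -- the pointers never coincide
  have hopen : ∀ t, 0 ≤ t → toIcoMod Real.two_pi_pos 0 (φ (i + 1) t - φ i t) ≠ 0 := by
    intro t ht h
    have hc : ContinuousAt (fun b => workload L ρ (φ i t) b (r i t)) (φ (i + 1) t) :=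
      ContinuousAt.comp (f := fun b => ((φ i t, b, r i t) : Config))
        (hreg.differentiableAt ht i).continuousAt (by fun_prop)
    have h0 := volume_coverageRegion_eq_zero_of_continuousAt hL hΩ hρpos (fun q hq => (hρ q hq).1)
      hρi h hc
    have := hrank t ht
    rw [agentHessian, hessianMatrix_localCost_eq_zero h0, Matrix.rank_zero] at this
    exact two_ne_zero this.symm
  set J : ℝ → Plane → ℝ := fun t => localCost L ρ f (φ i t) (φ (i + 1) t) (r i t) with hJ
  have hJ1 : ∀ t, fderiv ℝ (J t) = _ := fun t =>
    fderiv_localCost hL hΩ hρR hρmeas hf hf0 hf1 (φ i t) (φ (i + 1) t) (r i t)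
  have hJ2 : ∀ t p, HasFDerivAt (fderiv ℝ (J t)) _ p := fun t p =>
    hasFDerivAt_fderiv_localCost hL hΩ hρR hρmeas hf hf0 hf1 hf2 (φ i t) (φ (i + 1) t) (r i t) p
  have hcrit : ∀ t, 0 ≤ t → fderiv ℝ (J t) (pstar i t) = 0 := fun t ht => by
    have := (hopt t ht).1.2
    rwa [gradient, LinearIsometryEquiv.map_eq_zero_iff] at this
  set X : ℝ → Config := fun t => agentConfig (fun j => φ j t) (fun j => r j t) i with hX
  set X' : ℝ → Config := fun t => configVelocity L ρ kφ kr (fun j => φ j t) (fun j => r j t) i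
  set C := R * B₁ * (32 * M * (M + 1)) with hC
  -- the implicit function estimate
  have hest : ∀ t, 0 < t →
      ‖fderiv ℝ (fderiv ℝ (J t)) (pstar i t) (deriv (pstar i) t)‖ ≤ C * ‖X' t‖ := by
    intro t ht
    have hp : HasDerivAt (pstar i) (deriv (pstar i) t) t :=
      (hdiff.differentiableAt (Ici_mem_nhds ht)).hasDerivAt
    have hXt : HasDerivAt X (X' t) t :=
      (hsol.hasDerivWithinAt ht.le i).hasDerivAt (Ici_mem_nhds ht)
    -- The subregion is frozen at time t and only the position moves.
    have hu : HasDerivAt (fun s => fderiv ℝ (J t) (pstar i s))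
        (fderiv ℝ (fderiv ℝ (J t)) (pstar i t) (deriv (pstar i) t)) t :=
      (hJ2 t (pstar i t)).differentiableAt.hasFDerivAt.comp_hasDerivAt t hp
    refine norm_deriv_le_of_eventually_norm_sub_le hu hXt ?_
    have h1 : Tendsto (φ i) (𝓝 t) (𝓝 (φ i t)) :=
      (continuous_fst.tendsto _).comp hXt.continuousAt
    have h2 : Tendsto (φ (i + 1)) (𝓝 t) (𝓝 (φ (i + 1) t)) :=
      ((continuous_fst.comp continuous_snd).tendsto _).comp hXt.continuousAt
    filter_upwards [eventually_comparablePointers h1 h2 (hopen t ht.le), Ici_mem_nhds ht]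
      with s hs hs0
    have hd1 : |φ i t - φ i s| ≤ ‖X s - X t‖ := by
      rw [norm_sub_rev]; exact norm_fst_le (X t - X s)
    have hd2 : |φ (i + 1) t - φ (i + 1) s| ≤ ‖X s - X t‖ := by
      rw [norm_sub_rev]; exact (norm_fst_le (X t - X s).2).trans (norm_snd_le (X t - X s))
    have hd3 : ‖r i t - r i s‖ ≤ ‖X s - X t‖ := by
      rw [norm_sub_rev (X s)]
      exact (norm_snd_le (X t - X s).2).trans (norm_snd_le (X t - X s))
    have hslice : ContinuousOn (fun q => fderiv ℝ (fun p => f p q) (pstar i s))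
        (coverageRegion L) :=
      hf1.comp (f := fun q => (pstar i s, q)) (by fun_prop) fun q hq => ⟨trivial, hq⟩
    have := norm_integral_subregion_sub_le hL hΩ hM0 (norm_nonneg (X s - X t)) (hM t ht.le)
      (hM s hs0) hs hd1 hd2 hd3 (integrableOn_smul_of_continuousOn hK hρR hρmeas hslice)
      (mul_nonneg (abs_nonneg ρhigh) hB₁0) fun q hq => by
        rw [norm_smul]
        exact mul_le_mul (hρR q hq) (hB₁ (pstar i s, q) ⟨hpΩ s hs0, hq⟩) (norm_nonneg _)
          (abs_nonneg _)
    -- The vanishing gradient at time t is exchanged for the one at time s. Both terms then have the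
    -- same integrand, evaluated at p*(s), over two different subregions.
    rw [hcrit t ht.le, ← hcrit s hs0, hJ1 t, hJ1 s]
    exact this
  have hlim : Tendsto (fun t => C * ‖X' t‖) atTop (𝓝 0) := by
    simpa using (tendsto_configVelocity hkφ hkr hsol hreg i).norm.const_mul C
  have hbdd : ∀ t, 0 ≤ t →
      ‖fderiv ℝ (fderiv ℝ (J t)) (pstar i t)‖ ≤ R * B₂ * volume.real (coverageRegion L) := by
    intro t ht
    have hB : ∀ q ∈ coverageRegion L,
        ‖ρ q • fderiv ℝ (fderiv ℝ (fun p => f p q)) (pstar i t)‖ ≤ R * B₂ := fun q hq => by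
      rw [norm_smul]
      exact mul_le_mul (hρR q hq) (hB₂ (pstar i t, q) ⟨hpΩ t ht, hq⟩) (norm_nonneg _)
        (abs_nonneg _)
    rw [(hJ2 t (pstar i t)).fderiv]
    refine (norm_setIntegral_le_of_norm_le_const
      ((measure_mono Set.inter_subset_left).trans_lt hfin) fun q hq => hB q hq.1).trans ?_
    exact mul_le_mul_of_nonneg_left (measureReal_mono Set.inter_subset_left hfin.ne)
      ((norm_nonneg _).trans (hB _ (hpΩ t ht)))
  set D := R * B₂ * volume.real (coverageRegion L)
  have hcoord : Tendsto (fun t => (fun a => deriv (pstar i) t a : Fin 2 → ℝ)) atTop (𝓝 0) := by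
    refine tendsto_zero_of_tendsto_vecMul
      (M := fun t => agentHessian L ρ f φ r i t (pstar i t))
      (S := Set.univ.pi fun _ => Set.univ.pi fun _ => Set.Icc (-D) D)
      (isCompact_univ_pi fun _ => isCompact_univ_pi fun _ => isCompact_Icc) ?_
      (fun H hH => Matrix.det_ne_zero_of_rank_eq_card (by simpa using hcluster H hH)) ?_
    · filter_upwards [eventually_ge_atTop 0] with t ht a _ b _
      refine abs_le.1 ((abs_apply_single_le _ _ b).trans (le_trans ?_ (hbdd t ht)))
      simpa using (fderiv ℝ (fderiv ℝ (J t)) (pstar i t)).le_opNorm (EuclideanSpace.single a 1)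
    · refine tendsto_pi_nhds.2 fun b => squeeze_zero_norm' ?_ hlim
      filter_upwards [eventually_gt_atTop 0] with t ht
      rw [agentHessian, vecMul_hessianMatrix]
      exact (abs_apply_single_le _ _ b).trans (hest t ht)
  have := ((PiLp.continuous_toLp 2 fun _ : Fin 2 => ℝ).tendsto 0).comp hcoord
  exact this
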